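/- Let $1\le\tau\le m$ and $n$ be integers, write $x\in\mathbb{R}^{mn}$ as $m$ blocks $x^{[1]},\dots,x^{[m]}\in\mathbb{R}^n$, and use the Euclidean norm. Let $W\in\mathbb{R}^{mn\times mn}$ be symmetric positive semidefinite with positive semidefinite square root $\sqrt W$ and largest eigenvalue $\lambda_{\max}(W)$, let $\mathcal X\subseteq\mathbb{R}^{mn}$ be convex, and let $F:\mathcal X\to\mathbb{R}$ be $\mu$-strongly convex, $\mu>0$. The primal problem is $\min_{x\in\mathcal X}F(x)$ subject to $\sqrt W x=0$; the dual problem is $\min_{\eta\in\mathbb{R}^{mn}}\varphi(\eta)$ with $\varphi(\eta)=\max_{x\in\mathcal X}\langle\eta,\sqrt Wx\rangle-F(x)$, where the maximum is assumed to be attained for every $\eta$, at the point denoted $x^*(\sqrt W\eta)$. Let $x^*$ be an optimal solution of the primal problem and $\eta^*$ one of the dual problem, and put $L=\lambda_{\max}(W)/\mu$. Suppose $\varphi(\eta)=\mathbb{E}_{\xi\sim\nu}\phi(\eta,\xi)$ with $\phi(\cdot,\xi)$ differentiable and $\mathbb{E}_{\xi\sim\nu}\nabla\phi(\eta,\xi)=\nabla\varphi(\eta)$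 for all $\eta$ (gradients with respect to $\eta$, measurable in $(\eta,\xi)$ and integrable in $\xi$). Algorithm ASBCDS with learning rate $\gamma>0$ starts from a deterministic $\eta_0=\zeta_0=\lambda_0$, sets $\theta_1=1/m$, $\theta_{k+1}=\frac12\big(\sqrt{\theta_k^4+4\theta_k^2}-\theta_k^2\big)$ and $d_k=\theta_{k+1}(1-\theta_k)/\theta_k$, and for $k=0,1,\dots,K$ does the following. 1. $\lambda_{k+1}=\theta_{k+1}\zeta_k+(1-\theta_{k+1})\eta_k$. 2. For every block $p$, with a stale index $j=j_p(k+1)$, $\max(0,k-\tau)\le j\le k$, it forms $\omega_{j(k+1)}^{[p]}=\eta_j^{[p]}+\sum_{i=j}^{k}\Big(\prod_{l=j}^{i}d_l\Big)\big(\lambda_j^{[p]}-\eta_{j-1}^{[p]}\big)$ (just $\eta_0^{[p]}$ if $j=0$). 3. It draws a block $i_k$ uniformly from $\{1,\dots,m\}$ and a mini-batch of $M_k\ge1$ samples of law $\nu$; $G_{k+1}$ is the average of the gradients $\nabla\phi(\omega_{j(k+1)},\cdot)$ over the batch. Then $\zeta_{k+1}^{[i_k]}=\zeta_k^{[i_k]}-\frac{\gamma}{m\theta_{k+1}}G_{k+1}^{[i_k]}$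 and $\zeta_{k+1}^{[i]}=\zeta_k^{[i]}$ for $i\ne i_k$. 4. $\eta_{k+1}=\lambda_{k+1}+m\theta_{k+1}(\zeta_{k+1}-\zeta_k)$. The stale indices of iteration $k$ depend only on the information available before that iteration (which contains everything drawn earlier), and $i_k$ and the samples of the batch are mutually independent and independent of that information. **Claim.** For every $c>0$ there is a constant $C>0$, depending only on $c$, such that the following holds for all data as above. Let $\varepsilon>0$, and suppose that $$c\le 3L\gamma+12L\gamma\Big(\frac{\tau^2+\tau}{m}+2\tau\Big)^2\le1,\qquad \mathbb{E}\big\|\nabla\varphi(\omega_{j(k+1)})-G_{k+1}\big\|^2\le\frac{mL\theta_{k+1}\varepsilon}{8}\quad(0\le k\le K).$$ If the integer $K\ge 0$ satisfies $K\ge C\,\dfrac{m\tau\sqrt L}{\sqrt\varepsilon}\,\|\eta_0-\eta^*\|$, then $x_{K+1}=x^*(\sqrt W\eta_{K+1})$ satisfies $$\mathbb{E}\|x_{K+1}-x^*\|^2\le\frac{2\varepsilon}{\mu}\qquad\text{and}\qquad \mathbb{E}\|\sqrt W x_{K+1}\|^2\le\frac{2\lambda_{\max}(W)\,\varepsilon}{\mu},$$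 both expectations being finite. Thus $K=O(m\tau\sqrt L/\sqrt\varepsilon)$ iterations give $O(\varepsilon/\mu)$ and $O(\lambda_{\max}(W)\varepsilon/\mu)$. -/

import Mathlib

open MeasureTheory ProbabilityTheory

noncomputable section

namespace ASBCDS

/-- The space `ℝ^{mn}` of stacked vectors: `m` blocks of dimension `n`, Euclidean norm.
The `p`-th block of `x` consists of the coordinates `x (p, l)`, `l : Fin n`. -/
abbrev Vec (m n : ℕ) : Type := EuclideanSpace ℝ (Fin m × Fin n)

/-- Matrices acting on the stacked space. -/
abbrev Mat (m n : ℕ) : Type := Matrix (Fin m × Fin n) (Fin m × Fin n) ℝ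

/-! ### The primal and the dual problem -/

open scoped MatrixOrder in
/-- The positive semidefinite square root `√W`, as a linear operator on the stacked space. -/
def sqrtOp {m n : ℕ} (W : Mat m n) : Vec m n →L[ℝ] Vec m n :=
  Matrix.toEuclideanCLM (𝕜 := ℝ) (CFC.sqrt W)

/-- The largest eigenvalue of a symmetric matrix. -/
def lambdaMax {m n : ℕ} (W : Mat m n) : ℝ := sSup (spectrum ℝ W)

/-- `x` maximizes `⟨z, x⟩ - F(x)` over `X`. -/
def IsPrimalOf {m n : ℕ} (X : Set (Vec m n)) (F : Vec m n → ℝ) (z x : Vec m n) : Prop :=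
  x ∈ X ∧ IsMaxOn (fun y => inner ℝ z y - F y) X x

/-- `x*(z) = argmax_{x ∈ X} ⟨z, x⟩ - F(x)` (the maximizer is unique when `F` is strongly convex). -/
def primalOf {m n : ℕ} (X : Set (Vec m n)) (F : Vec m n → ℝ) (z : Vec m n) : Vec m n :=
  Classical.epsilon (IsPrimalOf X F z)

/-- The dual objective `φ(η) = max_{x ∈ X} ⟨η, √W x⟩ - F(x)`. -/
def dualObj {m n : ℕ} (W : Mat m n) (X : Set (Vec m n)) (F : Vec m n → ℝ) (η : Vec m n) : ℝ :=
  ⨆ x : X, (inner ℝ η (sqrtOp W (x : Vec m n)) - F (x : Vec m n))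

/-- `x` solves the primal problem `min_{x ∈ X} F(x)` subject to `√W x = 0`. -/
def IsPrimalOptimum {m n : ℕ} (W : Mat m n) (X : Set (Vec m n)) (F : Vec m n → ℝ)
    (x : Vec m n) : Prop :=
  (x ∈ X ∧ sqrtOp W x = 0) ∧ IsMinOn F {y | y ∈ X ∧ sqrtOp W y = 0} x

/-- `η` solves the dual problem `min φ(η)`. -/
def IsDualOptimum {m n : ℕ} (W : Mat m n) (X : Set (Vec m n)) (F : Vec m n → ℝ)
    (η : Vec m n) : Prop :=
  ∀ η' : Vec m n, dualObj W X F η ≤ dualObj W X F η'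

/-! ### The algorithm, along one sample path -/

/-- The step parameters: `θ_1 = 1/m`, `θ_{k+1} = (√(θ_k⁴ + 4 θ_k²) - θ_k²) / 2` for `k ≥ 1`.
The value at index `0` is never used. -/
def theta (m : ℕ) : ℕ → ℝ
  | 0 => 0
  | 1 => 1 / (m : ℝ)
  | k + 2 => (Real.sqrt (theta m (k + 1) ^ 4 + 4 * theta m (k + 1) ^ 2) - theta m (k + 1) ^ 2) / 2

/-- `d_k = θ_{k+1} (1 - θ_k) / θ_k`. -/
def dCoef (m k : ℕ) : ℝ := theta m (k + 1) * (1 - theta m k) / theta m k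

/-- `ρ_i = ∏_{l = j}^{i} d_l`, where `j` is the index of the stale information. -/
def rho (m j i : ℕ) : ℝ := ∏ l ∈ Finset.Icc j i, dCoef m l

/-- The compensated stale point `ω_{j(k+1)}`: its `p`-th block is
`η_j^{[p]} + ∑_{i=j}^{k} ρ_i (λ_j^{[p]} - η_{j-1}^{[p]})` with `j = j_p(k+1)`.
For `j = 0` natural subtraction gives `η_{-1} = η_0 = λ_0`, so there is no compensation. -/
def compensated {m n : ℕ} (eta lam : ℕ → Vec m n) (j : Fin m → ℕ) (k : ℕ) : Vec m n :=
  WithLp.toLp 2 fun c =>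
    eta (j c.1) c + ∑ i ∈ Finset.Icc (j c.1) k, rho m (j c.1) i *
      (lam (j c.1) c - eta (j c.1 - 1) c)

/-- `-s` times the `b`-th block of `g`, and zero in the other blocks. -/
def blockStep {m n : ℕ} (s : ℝ) (b : Fin m) (g : Vec m n) : Vec m n :=
  WithLp.toLp 2 fun c => if c.1 = b then -(s * g c) else 0

/-- Everything computed after `k` iterations: `eta j`, `lam j` and `zeta j` for `j ≤ k`
(entries with larger index are placeholders). -/
structure History (m n : ℕ) where
  eta : ℕ → Vec m n
  lam : ℕ → Vec m n
  zeta : ℕ → Vec m n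

/-- One iteration (number `k`) with learning rate `γ`, delays `j p = j_p(k+1)`, selected block `b`
and stochastic gradient field `g`. -/
def iterate {m n : ℕ} (γ : ℝ) (k : ℕ) (j : Fin m → ℕ) (b : Fin m) (g : Vec m n → Vec m n)
    (H : History m n) : History m n :=
  let lam' : Vec m n := theta m (k + 1) • H.zeta k + (1 - theta m (k + 1)) • H.eta k
  let om : Vec m n := compensated H.eta H.lam j k
  let zeta' : Vec m n := H.zeta k + blockStep (γ / (m * theta m (k + 1))) b (g om)
  let eta' : Vec m n := lam' + ((m : ℝ) * theta m (k + 1)) • (zeta' - H.zeta k)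
  { eta := Function.update H.eta (k + 1) eta'
    lam := Function.update H.lam (k + 1) lam'
    zeta := Function.update H.zeta (k + 1) zeta' }

/-- The history after `k` iterations, from `η_0 = ζ_0 = λ_0`. -/
def history {m n : ℕ} (γ : ℝ) (η₀ : Vec m n) (j : ℕ → Fin m → ℕ) (b : ℕ → Fin m)
    (g : ℕ → Vec m n → Vec m n) : ℕ → History m n
  | 0 => { eta := fun _ => η₀, lam := fun _ => η₀, zeta := fun _ => η₀ }
  | k + 1 => iterate γ k (j k) (b k) (g k) (history γ η₀ j b g k)

/-- The iterate `η_k`. -/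
def etaSeq {m n : ℕ} (γ : ℝ) (η₀ : Vec m n) (j : ℕ → Fin m → ℕ) (b : ℕ → Fin m)
    (g : ℕ → Vec m n → Vec m n) (k : ℕ) : Vec m n := (history γ η₀ j b g k).eta k

/-- The iterate `λ_k`. -/
def lamSeq {m n : ℕ} (γ : ℝ) (η₀ : Vec m n) (j : ℕ → Fin m → ℕ) (b : ℕ → Fin m)
    (g : ℕ → Vec m n → Vec m n) (k : ℕ) : Vec m n := (history γ η₀ j b g k).lam k

/-- The iterate `ζ_k`. -/
def zetaSeq {m n : ℕ} (γ : ℝ) (η₀ : Vec m n) (j : ℕ → Fin m → ℕ) (b : ℕ → Fin m)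
    (g : ℕ → Vec m n → Vec m n) (k : ℕ) : Vec m n := (history γ η₀ j b g k).zeta k

/-- The point `ω_{j(k+1)}` at which the stochastic gradient of iteration `k` is evaluated. -/
def omegaSeq {m n : ℕ} (γ : ℝ) (η₀ : Vec m n) (j : ℕ → Fin m → ℕ) (b : ℕ → Fin m)
    (g : ℕ → Vec m n → Vec m n) (k : ℕ) : Vec m n :=
  compensated (history γ η₀ j b g k).eta (history γ η₀ j b g k).lam (j k) k

section Recurrences

variable {m n : ℕ} (γ : ℝ) (η₀ : Vec m n) (j : ℕ → Fin m → ℕ) (b : ℕ → Fin m)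
  (g : ℕ → Vec m n → Vec m n)

theorem history_frozen {i k : ℕ} (h : i ≤ k) :
    (history γ η₀ j b g k).eta i = etaSeq γ η₀ j b g i ∧
      (history γ η₀ j b g k).lam i = lamSeq γ η₀ j b g i ∧
      (history γ η₀ j b g k).zeta i = zetaSeq γ η₀ j b g i := by
  induction k, h using Nat.le_induction with
  | base => exact ⟨rfl, rfl, rfl⟩
  | succ k hk ih =>
    have hne : i ≠ k + 1 := by omega
    simpa [history, iterate, Function.update_of_ne hne] using ih

theorem lamSeq_succ (k : ℕ) :
    lamSeq γ η₀ j b g (k + 1) =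
      theta m (k + 1) • zetaSeq γ η₀ j b g k + (1 - theta m (k + 1)) • etaSeq γ η₀ j b g k := by
  simp [lamSeq, zetaSeq, etaSeq, history, iterate]

theorem zetaSeq_succ (k : ℕ) :
    zetaSeq γ η₀ j b g (k + 1) =
      zetaSeq γ η₀ j b g k +
        blockStep (γ / (m * theta m (k + 1))) (b k) (g k (omegaSeq γ η₀ j b g k)) := by
  simp [zetaSeq, omegaSeq, history, iterate]

theorem etaSeq_succ (k : ℕ) :
    etaSeq γ η₀ j b g (k + 1) =
      lamSeq γ η₀ j b g (k + 1) + ((m : ℝ) * theta m (k + 1)) •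
        (zetaSeq γ η₀ j b g (k + 1) - zetaSeq γ η₀ j b g k) := by
  simp [lamSeq, zetaSeq, etaSeq, history, iterate]

theorem omegaSeq_eq (k : ℕ) (hj : ∀ p, j k p ≤ k) :
    omegaSeq γ η₀ j b g k =
      compensated (etaSeq γ η₀ j b g) (lamSeq γ η₀ j b g) (j k) k := by
  unfold omegaSeq compensated
  congr 1
  funext c
  rw [(history_frozen γ η₀ j b g (hj c.1)).1, (history_frozen γ η₀ j b g (hj c.1)).2.1,
    (history_frozen γ η₀ j b g ((Nat.sub_le _ 1).trans (hj c.1))).1]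

end Recurrences

/-! ### The stochastic model -/

/-- `ϕ(·, ξ)`, `ξ ∼ ν`, is a stochastic version of `φ`: `φ(η) = 𝔼 ϕ(η, ξ)`, and the stochastic
gradient `∇ϕ(η, ξ)` is an unbiased estimate of `∇φ(η)`. -/
structure IsStochasticOracle {m n : ℕ} {Ξ : Type*} [MeasurableSpace Ξ] (φ : Vec m n → ℝ)
    (ϕ : Vec m n → Ξ → ℝ) (ν : Measure Ξ) : Prop where
  integrable_value : ∀ η, Integrable (ϕ η) ν
  integral_value : ∀ η, ∫ ξ, ϕ η ξ ∂ν = φ η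
  differentiable : ∀ ξ, Differentiable ℝ (fun η => ϕ η ξ)
  measurable_gradient :
    Measurable (fun q : Vec m n × Ξ => gradient (fun η => ϕ η q.2) q.1)
  integrable_gradient : ∀ η, Integrable (fun ξ => gradient (fun η' => ϕ η' ξ) η) ν
  integral_gradient : ∀ η, ∫ ξ, gradient (fun η' => ϕ η' ξ) η ∂ν = gradient φ η

/-- The average of `M` stochastic gradients (`M = 1`: a single stochastic gradient). -/
def batchGradient {m n : ℕ} {Ξ : Type*} (ϕ : Vec m n → Ξ → ℝ) {M : ℕ} (ξ : Fin M → Ξ)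
    (η : Vec m n) : Vec m n :=
  (M : ℝ)⁻¹ • ∑ r, gradient (fun η' => ϕ η' (ξ r)) η

/-- The randomness of the algorithm. `ℱ k` is the information available before iteration `k`.
In iteration `k` a block `b k` is drawn uniformly and `Mb k ≥ 1` independent samples of law `ν`
are drawn, independently of each other and of the past; the stale indices `j k p = j_p(k+1)`
depend only on the past and the delay is at most `τ`. -/
structure IsSampling {m : ℕ} {Ω Ξ : Type*} {mΩ : MeasurableSpace Ω} [MeasurableSpace Ξ]
    (P : Measure Ω) (ℱ : Filtration ℕ mΩ) (ν : Measure Ξ) (τ : ℕ) (Mb : ℕ → ℕ)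
    (j : ℕ → Fin m → Ω → ℕ) (b : ℕ → Ω → Fin m) (ξ : (k : ℕ) → Ω → Fin (Mb k) → Ξ) : Prop where
  batch_pos : ∀ k, 1 ≤ Mb k
  delay_measurable : ∀ k p, Measurable[ℱ k] (j k p)
  delay_le : ∀ k p s, j k p s ≤ k
  le_delay_add : ∀ k p s, k ≤ j k p s + τ
  draw_measurable : ∀ k, Measurable[ℱ (k + 1)] (fun s => (b k s, ξ k s))
  draw_law : ∀ k, P.map (fun s => (b k s, ξ k s)) =
    (uniformOn (Set.univ : Set (Fin m))).prod (Measure.pi fun _ : Fin (Mb k) => ν)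
  draw_indep : ∀ k, Indep
    (MeasurableSpace.comap (fun s => (b k s, ξ k s)) inferInstance) (ℱ k) P

end ASBCDS

end

noncomputable section

namespace ASBCDS

/-! ### The step parameters -/

/-! The dual objective φ is convex with `L`-Lipschitz gradient `√W x*(√W η)`. At a dual optimum this
gradient vanishes, so the corresponding primal point is feasible, and strong convexity of `F` gives
`(μ/2)‖x*(√W η) - x*‖² ≤ φ(η) - φ(η*)` (`norm_primalOf_sub_sq_le`). It therefore suffices to bring
the expected dual gap below `ε`. The consensus bound then costs a factor `λ_max(W)`, because `√W x*
= 0`.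

With `t_k = 1/θ_{k+1}`, the gap is followed through the potential `t_k² (φ(η_{k+1}) - φ(η*)) +
m²/(2γ) ‖ζ_{k+1} - η*‖²`, whose weights telescope because `t_{k+1}² - t_{k+1} = t_k²`. Averaging
over the block and the batch (`IsSampling.integral_step`), one iteration adds an error proportional
to `E‖λ_{k+1} - ω‖²`, caused by the stale gradient, and a multiple of `-(3/2) E‖∇φ(ω)‖² + (1 + Lγ)
E‖G‖²` (`IsRun.expected_step`).

The compensation in `ω` extrapolates the momentum `λ_{i+1} - η_i` as if no block update occurred.
The stale error is thus a weighted sum of recent updates, of total weight `delaySum`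
(`abs_sub_compensated_le`, `delaySum_le`). As `t_k` grows only by a bounded factor over the delay
window, these errors sum to a small multiple of `∑ t_k² E‖G_k‖²`, which the step size condition lets
the negative gradient term absorb. Only the variance remains, at most `(ε/2) t_K²` in total
(`sum_step_le`). The growth `t_K ≥ K/2` makes the initial potential negligible after the stated
number of iterations (`final_bound`). -/

theorem theta_pos {m : ℕ} (hm : 1 ≤ m) (k : ℕ) : 0 < theta m (k + 1) := by
  induction k with
  | zero =>
    have : (0 : ℝ) < m := by exact_mod_cast hm
    simpa [theta] using this
  | succ k ih =>
    have h : theta m (k + 1) ^ 2 <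
        Real.sqrt (theta m (k + 1) ^ 4 + 4 * theta m (k + 1) ^ 2) := by
      apply Real.lt_sqrt_of_sq_lt
      have : 0 < theta m (k + 1) ^ 2 := by positivity
      nlinarith
    rw [theta]
    linarith

/-- The new parameter is the positive root of `x² + θ² x - θ² = 0`, with `θ` the previous one. -/
theorem theta_sq {m : ℕ} (k : ℕ) :
    theta m (k + 2) ^ 2 = theta m (k + 1) ^ 2 * (1 - theta m (k + 2)) := by
  have h : Real.sqrt (theta m (k + 1) ^ 4 + 4 * theta m (k + 1) ^ 2) ^ 2 =
      theta m (k + 1) ^ 4 + 4 * theta m (k + 1) ^ 2 := Real.sq_sqrt (by positivity)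
  rw [theta]
  linear_combination h / 4

theorem theta_antitone {m : ℕ} (hm : 1 ≤ m) (k : ℕ) : theta m (k + 2) ≤ theta m (k + 1) := by
  have h := theta_sq (m := m) k
  have h1 := theta_pos hm k
  have h2 := theta_pos hm (k + 1)
  refine le_of_sq_le_sq ?_ h1.le
  have : 0 < theta m (k + 1) ^ 2 := by positivity
  nlinarith

theorem theta_le {m : ℕ} (hm : 1 ≤ m) (k : ℕ) : theta m (k + 1) ≤ 1 / m := by
  induction k with
  | zero => simp [theta]
  | succ k ih => exact (theta_antitone hm k).trans ih

theorem mul_theta_le {m : ℕ} (hm : 1 ≤ m) (k : ℕ) : m * theta m (k + 1) ≤ 1 := by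
  have h0 : (0 : ℝ) < m := by exact_mod_cast hm
  have := theta_le hm k
  rwa [le_div_iff₀ h0, mul_comm] at this

theorem theta_le_one {m : ℕ} (hm : 1 ≤ m) (k : ℕ) : theta m (k + 1) ≤ 1 := by
  have h0 : (1 : ℝ) ≤ m := by exact_mod_cast hm
  have := mul_theta_le hm k
  have := theta_pos hm k
  nlinarith

theorem dCoef_nonneg {m : ℕ} (hm : 1 ≤ m) (k : ℕ) : 0 ≤ dCoef m (k + 1) := by
  have h1 := theta_pos hm k
  have h2 := theta_pos hm (k + 1)
  have h3 := theta_le_one hm k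
  exact div_nonneg (mul_nonneg h2.le (by linarith)) h1.le

/-- Monotonicity of `θ` makes the momentum factors contractive, so errors in the extrapolated
momentum are not amplified over the delay. -/
theorem dCoef_le_one {m : ℕ} (hm : 1 ≤ m) (k : ℕ) : dCoef m (k + 1) ≤ 1 := by
  have h1 := theta_pos hm k
  have h2 := theta_pos hm (k + 1)
  have h3 := theta_antitone hm k
  unfold dCoef
  rw [div_le_one h1]
  nlinarith

/-- The reciprocals `1 / θ_{k+1}`. -/
def recip (m k : ℕ) : ℝ := (theta m (k + 1))⁻¹

theorem recip_zero (m : ℕ) : recip m 0 = m := by simp [recip, theta]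

theorem recip_pos {m : ℕ} (hm : 1 ≤ m) (k : ℕ) : 0 < recip m k := inv_pos.2 (theta_pos hm k)

theorem recip_mul_theta {m : ℕ} (hm : 1 ≤ m) (k : ℕ) : recip m k * theta m (k + 1) = 1 :=
  inv_mul_cancel₀ (theta_pos hm k).ne'

theorem recip_ge {m : ℕ} (hm : 1 ≤ m) (k : ℕ) : m ≤ recip m k := by
  have h := mul_theta_le hm k
  rwa [← le_div_iff₀ (theta_pos hm k), one_div] at h

/-- This identity makes the weight of the old gap in one step equal to the weight of the new gap in
the preceding step. -/
theorem recip_succ {m : ℕ} (hm : 1 ≤ m) (k : ℕ) :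
    recip m (k + 1) ^ 2 - recip m (k + 1) = recip m k ^ 2 := by
  have h := theta_sq (m := m) k
  have h1 := (theta_pos hm k).ne'
  have h2 := (theta_pos hm (k + 1)).ne'
  unfold recip
  field_simp
  linear_combination -h

/-- The increment is `√(t² + 1/4) + 1/2 - t`, decreasing in `t`. At `t = 1` it is about `0.618`,
just below `5/8`. -/
theorem recip_succ_le {m : ℕ} (hm : 1 ≤ m) (k : ℕ) : recip m (k + 1) ≤ recip m k + 5 / 8 := by
  have h := recip_succ hm k
  have h0 : (1 : ℝ) ≤ m := by exact_mod_cast hm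
  have h1 := recip_ge hm k
  by_contra! hlt
  nlinarith

theorem le_recip_succ {m : ℕ} (hm : 1 ≤ m) (k : ℕ) : recip m k + 1 / 2 ≤ recip m (k + 1) := by
  have h := recip_succ hm k
  have h0 : (1 : ℝ) ≤ m := by exact_mod_cast hm
  have h1 := recip_ge hm k
  have h2 := recip_ge hm (k + 1)
  by_contra! hlt
  nlinarith

theorem recip_add_le {m : ℕ} (hm : 1 ≤ m) (k d : ℕ) :
    recip m (k + d) ≤ recip m k + 5 / 8 * d := by
  induction d with
  | zero => simp
  | succ d ih =>
    have := recip_succ_le hm (k + d)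
    push_cast
    rw [← add_assoc]
    linarith

theorem half_le_recip {m : ℕ} (hm : 1 ≤ m) (k : ℕ) : (k : ℝ) / 2 ≤ recip m k := by
  induction k with
  | zero => simpa using (recip_pos hm 0).le
  | succ d ih =>
    have := le_recip_succ hm d
    push_cast
    linarith

/-- Each later term is a difference of consecutive squares, so the sum telescopes; the first term
costs `m ≤ m²`. This sums the variance contributions. -/
theorem sum_recip_le {m : ℕ} (hm : 1 ≤ m) (k : ℕ) :
    ∑ i ∈ Finset.range (k + 1), recip m i ≤ recip m k ^ 2 := by
  induction k with
  | zero =>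
    have h0 : (1 : ℝ) ≤ m := by exact_mod_cast hm
    simp only [zero_add, Finset.range_one, Finset.sum_singleton, recip_zero]
    nlinarith
  | succ k ih =>
    rw [Finset.sum_range_succ]
    linarith [recip_succ hm k]

/-! ### The effect of the delays -/

/-- The weight of a block update that is `d` iterations old in the error of the stale point. -/
def delayWeight (m τ d : ℕ) : ℝ :=
  (if d ≤ τ then 1 else 0) + (if d ≤ τ + 1 then (d : ℝ) / m else 0)

theorem delayWeight_nonneg (m τ d : ℕ) : 0 ≤ delayWeight m τ d := by
  unfold delayWeight
  positivity

/-- The total weight of the block updates in the error of the stale point. -/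
def delaySum (m τ : ℕ) : ℝ := τ + ((τ : ℝ) + 1) * (τ + 2) / (2 * m)

theorem sum_delayWeight {m : ℕ} (hm : 1 ≤ m) (τ : ℕ) :
    ∑ d ∈ Finset.range (τ + 1), delayWeight m τ (d + 1) = delaySum m τ := by
  have h0 : (m : ℝ) ≠ 0 := by positivity
  have h1 : ∑ d ∈ Finset.range (τ + 1), (if d + 1 ≤ τ then (1 : ℝ) else 0) = τ := by
    rw [Finset.sum_range_succ, if_neg (by omega), add_zero,
      Finset.sum_congr rfl fun d hd => if_pos (by have := Finset.mem_range.1 hd; omega)]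
    simp
  have h2 : ∀ t : ℕ, ∑ d ∈ Finset.range (t + 1), (((d + 1 : ℕ) : ℝ) / m) =
      ((t : ℝ) + 1) * (t + 2) / (2 * m) := by
    intro t
    induction t with
    | zero =>
      simp
      field_simp
    | succ t ih =>
      rw [Finset.sum_range_succ, ih]
      push_cast
      field_simp
      ring
  unfold delayWeight delaySum
  rw [Finset.sum_add_distrib, h1, ← h2 τ]
  congr 1
  refine Finset.sum_congr rfl fun d hd => if_pos ?_
  have := Finset.mem_range.1 hd
  omega

theorem sum_range_delayWeight_le {m : ℕ} (hm : 1 ≤ m) (τ k : ℕ) :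
    ∑ d ∈ Finset.range k, delayWeight m τ (d + 1) ≤ delaySum m τ := by
  rw [← sum_delayWeight hm τ]
  by_cases h : k ≤ τ + 1
  · exact Finset.sum_le_sum_of_subset_of_nonneg (Finset.range_mono h)
      fun _ _ _ => delayWeight_nonneg _ _ _
  · rw [← Finset.sum_subset (Finset.range_mono (by omega : τ + 1 ≤ k))]
    intro d _ hd
    have hd' : τ + 1 ≤ d := by simpa using hd
    unfold delayWeight
    rw [if_neg (by omega), if_neg (by omega), add_zero]

theorem sum_delayWeight_sub_le {m : ℕ} (hm : 1 ≤ m) (τ k : ℕ) :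
    ∑ i ∈ Finset.range k, delayWeight m τ (k - i) ≤ delaySum m τ := by
  rw [← Finset.sum_range_reflect]
  refine le_trans (le_of_eq (Finset.sum_congr rfl fun d hd => ?_)) (sum_range_delayWeight_le hm τ k)
  have := Finset.mem_range.1 hd
  congr 1
  omega

theorem delaySum_nonneg (m τ : ℕ) : 0 ≤ delaySum m τ := by
  unfold delaySum
  positivity

theorem delaySum_le {m τ : ℕ} (hτ : 1 ≤ τ) (hm : τ ≤ m) :
    delaySum m τ ≤ ((τ : ℝ) ^ 2 + τ) / m + 2 * τ := by
  have h1 : (1 : ℝ) ≤ τ := by exact_mod_cast hτ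
  have h2 : (τ : ℝ) ≤ m := by exact_mod_cast hm
  have h0 : (0 : ℝ) < m := by linarith
  unfold delaySum
  rw [← sub_nonneg]
  have : ((τ : ℝ) ^ 2 + τ) / m + 2 * τ - (τ + ((τ : ℝ) + 1) * (τ + 2) / (2 * m)) =
      (τ ^ 2 - τ - 2 + 2 * τ * m) / (2 * m) := by
    field_simp
    ring
  rw [this]
  apply div_nonneg _ (by linarith)
  nlinarith

/-- Along one coordinate, the distance between the point `λ_{k+1}` and its compensated stale
version is controlled by the block updates made in the meantime. -/
theorem abs_sub_compensated_le {m τ : ℕ} (hm : 1 ≤ m) (eta lam zeta : ℕ → ℝ)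
    (h0 : lam 0 = eta 0) (hz : zeta 0 = eta 0)
    (hlam : ∀ k, lam (k + 1) = theta m (k + 1) * zeta k + (1 - theta m (k + 1)) * eta k)
    (heta : ∀ k, eta (k + 1) = lam (k + 1) + m * theta m (k + 1) * (zeta (k + 1) - zeta k))
    {j k : ℕ} (hjk : j ≤ k) (hkj : k ≤ j + τ) :
    |lam (k + 1) - (eta j + ∑ i ∈ Finset.Icc j k, rho m j i * (lam j - eta (j - 1)))| ≤
      ∑ i ∈ Finset.range k, delayWeight m τ (k - i) *
        |m * theta m (i + 1) * (zeta (i + 1) - zeta i)| := by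
  have hm0 : (0 : ℝ) < m := by exact_mod_cast hm
  set h : ℕ → ℝ := fun i => m * theta m (i + 1) * (zeta (i + 1) - zeta i) with hh
  set D : ℝ := lam j - eta (j - 1) with hD
  set E : ℕ → ℝ := fun i => lam (i + 1) - eta i - rho m j i * D with hE
  -- Momentum recursion: without an update (`h i = 0`) the momentum is just multiplied by `d_{i+1}`,
  -- which is what the compensation assumes.
  have hrec : ∀ i, lam (i + 2) - eta (i + 1) = dCoef m (i + 1) * (lam (i + 1) - eta i) +
      theta m (i + 2) * (1 - m * theta m (i + 1)) / (m * theta m (i + 1)) * h i := by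
    intro i
    have h1 := (theta_pos hm i).ne'
    simp only [hh, dCoef]
    rw [hlam (i + 1), heta i, hlam i]
    field_simp
    ring
  have hβ : ∀ i, |theta m (i + 2) * (1 - m * theta m (i + 1)) / (m * theta m (i + 1))| ≤
      1 / m := by
    intro i
    have h1 := theta_pos hm i
    have h2 := theta_pos hm (i + 1)
    have h3 := theta_antitone hm i
    have h4 := mul_theta_le hm i
    rw [abs_of_nonneg (div_nonneg (mul_nonneg h2.le (by linarith)) (by positivity)),
      div_le_div_iff₀ (by positivity) hm0]
    have : theta m (i + 2) * (1 - m * theta m (i + 1)) ≤ theta m (i + 1) * 1 := by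
      apply mul_le_mul h3 _ (by linarith) h1.le
      have : 0 < m * theta m (i + 1) := by positivity
      linarith
    nlinarith
  have hEstart : |E j| ≤ ∑ i ∈ Finset.range j, if j ≤ i + 1 then 1 / m * |h i| else 0 := by
    cases j with
    | zero =>
      have h1 : D = 0 := by simp [hD, h0]
      have h2 : E 0 = 0 := by
        simp only [hE, h1, hlam 0, hz]
        ring
      simp [h2]
    | succ j =>
      have h1 : E (j + 1) = theta m (j + 2) * (1 - m * theta m (j + 1)) /
          (m * theta m (j + 1)) * h j := by
        simp only [hE, hD, rho, Finset.Icc_self, Finset.prod_singleton, Nat.add_sub_cancel]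
        linear_combination hrec j
      rw [Finset.sum_range_succ, if_pos le_rfl, h1, abs_mul]
      have : (0 : ℝ) ≤ ∑ i ∈ Finset.range j, if j + 1 ≤ i + 1 then 1 / (m : ℝ) * |h i| else 0 :=
        Finset.sum_nonneg fun i _ => by positivity
      have := mul_le_mul_of_nonneg_right (hβ j) (abs_nonneg (h j))
      linarith
  -- `E` is the error of the predicted momentum: it is contracted by `d` and receives at most `1/m`
  -- of each new update. The update at `i = j - 1` counts too, since `D` is the momentum before that
  -- update acts.
  have hEbound : ∀ k, j ≤ k →
      |E k| ≤ ∑ i ∈ Finset.range k, if j ≤ i + 1 then 1 / m * |h i| else 0 := by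
    intro k hk
    induction k, hk using Nat.le_induction with
    | base => exact hEstart
    | succ k hk ih =>
      have h1 : E (k + 1) = dCoef m (k + 1) * E k + theta m (k + 2) *
          (1 - m * theta m (k + 1)) / (m * theta m (k + 1)) * h k := by
        have : rho m j (k + 1) = rho m j k * dCoef m (k + 1) :=
          Finset.prod_Icc_succ_top (by omega) _
        simp only [hE, this]
        linear_combination hrec k
      rw [Finset.sum_range_succ, if_pos (by omega), h1]
      refine (abs_add_le _ _).trans (add_le_add ?_ ?_)
      · rw [abs_mul, abs_of_nonneg (dCoef_nonneg hm k)]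
        exact (mul_le_of_le_one_left (abs_nonneg _) (dCoef_le_one hm k)).trans ih
      · rw [abs_mul]
        exact mul_le_mul_of_nonneg_right (hβ k) (abs_nonneg (h k))
  -- The position error accumulates the updates since `j`, each with weight one, and the momentum
  -- errors up to `k`, in which update `i` appears at most `k - i` times with weight `1/m`.
  have key : ∀ k, j ≤ k →
      |lam (k + 1) - (eta j + ∑ i ∈ Finset.Icc j k, rho m j i * D)| ≤
        ∑ i ∈ Finset.range k, ((if j ≤ i then 1 else 0) +
          (if j ≤ i + 1 then ((k : ℝ) - i) / m else 0)) * |h i| := by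
    intro k hk
    induction k, hk using Nat.le_induction with
    | base =>
      have h1 : lam (j + 1) - (eta j + ∑ i ∈ Finset.Icc j j, rho m j i * D) = E j := by
        simp only [hE, Finset.Icc_self, Finset.sum_singleton]
        ring
      rw [h1]
      refine hEstart.trans (Finset.sum_le_sum fun i hi => ?_)
      have hi' := Finset.mem_range.1 hi
      rw [if_neg (by omega : ¬j ≤ i), zero_add]
      split_ifs with hij
      · have : (j : ℝ) = i + 1 := by exact_mod_cast (by omega : j = i + 1)
        rw [this, add_sub_cancel_left]
      · simp
    | succ k hk ih =>
      have h1 : lam (k + 1 + 1) - (eta j + ∑ i ∈ Finset.Icc j (k + 1), rho m j i * D) =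
          (lam (k + 1) - (eta j + ∑ i ∈ Finset.Icc j k, rho m j i * D)) + E (k + 1) + h k := by
        rw [Finset.sum_Icc_succ_top (by omega)]
        simp only [hE, hh]
        linear_combination heta k
      rw [h1]
      have h2 := hEbound (k + 1) (by omega)
      refine (abs_add_le _ _).trans ?_
      refine (add_le_add_left ((abs_add_le _ _).trans (add_le_add ih h2)) _).trans (le_of_eq ?_)
      rw [Finset.sum_range_succ, Finset.sum_range_succ, if_pos (by omega : j ≤ k + 1),
        ← add_assoc, ← Finset.sum_add_distrib, if_pos (by omega : j ≤ k),
        if_pos (by omega : j ≤ k + 1), add_assoc]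
      congr 1
      · refine Finset.sum_congr rfl fun i _ => ?_
        push_cast
        by_cases hij : j ≤ i + 1
        · rw [if_pos hij, if_pos hij, if_pos hij]
          ring
        · simp only [if_neg hij]
          ring
      · push_cast
        ring
  refine (key k hjk).trans (Finset.sum_le_sum fun i hi => ?_)
  have hi' := Finset.mem_range.1 hi
  have hki : ((k - i : ℕ) : ℝ) = (k : ℝ) - i := Nat.cast_sub hi'.le
  have hpos : (0 : ℝ) ≤ ((k : ℝ) - i) / m := by
    rw [← hki]
    positivity
  refine mul_le_mul_of_nonneg_right ?_ (abs_nonneg _)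
  unfold delayWeight
  rw [hki]
  refine add_le_add ?_ ?_ <;> split_ifs <;> first | omega | linarith

/-! ### The square root and the largest eigenvalue -/

open scoped MatrixOrder in
theorem sqrtOp_isSelfAdjoint {m n : ℕ} (W : Mat m n) : IsSelfAdjoint (sqrtOp W) := by
  have : IsSelfAdjoint (CFC.sqrt W) := (CFC.sqrt_nonneg W).isSelfAdjoint
  exact this.map (Matrix.toEuclideanCLM (𝕜 := ℝ) (n := Fin m × Fin n))

theorem inner_sqrtOp {m n : ℕ} (W : Mat m n) (x y : Vec m n) :
    inner ℝ (sqrtOp W x) y = inner ℝ x (sqrtOp W y) := by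
  have h := (sqrtOp_isSelfAdjoint W).isSymmetric
  exact h x y

theorem inner_sqrtOp_comm {m n : ℕ} (W : Mat m n) (x y : Vec m n) :
    inner ℝ (sqrtOp W x) y = inner ℝ (sqrtOp W y) x := by
  rw [inner_sqrtOp, real_inner_comm]

open scoped MatrixOrder in
-- The left side is the quadratic form of `W`, and the spectral bound gives `W ≤ λ_max(W) I` in the
-- Loewner order.
theorem norm_sqrtOp_sq_le {m n : ℕ} {W : Mat m n} (hW : W.PosSemidef) (x : Vec m n) :
    ‖sqrtOp W x‖ ^ 2 ≤ lambdaMax W * ‖x‖ ^ 2 := by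
  have hle : W ≤ algebraMap ℝ (Mat m n) (lambdaMax W) :=
    le_algebraMap_of_spectrum_le (fun r hr =>
      le_csSup (Matrix.finite_real_spectrum (A := W)).bddAbove hr) hW.1
  have hpos : (algebraMap ℝ (Mat m n) (lambdaMax W) - W).PosSemidef := Matrix.le_iff.1 hle
  have hsq : CFC.sqrt W * CFC.sqrt W = W :=
    CFC.sqrt_mul_sqrt_self W (Matrix.nonneg_iff_posSemidef.2 hW)
  have h1 : ‖sqrtOp W x‖ ^ 2 = inner ℝ x (Matrix.toEuclideanCLM (𝕜 := ℝ) W x) := by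
    rw [← real_inner_self_eq_norm_sq, inner_sqrtOp]
    conv_rhs => rw [← hsq, map_mul]
    rfl
  have h2 : (0 : ℝ) ≤ inner ℝ x (Matrix.toEuclideanCLM (𝕜 := ℝ)
      (algebraMap ℝ (Mat m n) (lambdaMax W) - W) x) := by
    have := (Matrix.isPositive_toEuclideanLin_iff.2 hpos).inner_nonneg_right x
    exact this
  rw [map_sub, AlgEquivClass.commutes, sub_apply, inner_sub_right] at h2
  rw [h1]
  rw [ContinuousLinearMap.algebraMap_apply, real_inner_smul_right, real_inner_self_eq_norm_sq] at h2
  linarith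

/-! ### Smoothness of the dual objective -/

/-- The strong concavity of `y ↦ ⟨z, y⟩ - F(y)` at its maximizer. -/
theorem IsPrimalOf.quadratic_growth {m n : ℕ} {X : Set (Vec m n)} {F : Vec m n → ℝ} {μ : ℝ}
    (hF : StrongConvexOn X μ F) {z x y : Vec m n} (hx : IsPrimalOf X F z x) (hy : y ∈ X) :
    inner ℝ z y - F y + μ / 2 * ‖y - x‖ ^ 2 ≤ inner ℝ z x - F x := by
  set Q : ℝ := μ / 2 * ‖y - x‖ ^ 2 with hQ
  -- Test the maximizer against the point at parameter `t` on the segment to `y` and divide by `t`;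
  -- letting `t → 0` then recovers the full quadratic term.
  have key : ∀ t : ℝ, 0 < t → t < 1 →
      inner ℝ z y - F y + (1 - t) * Q ≤ inner ℝ z x - F x := by
    intro t h0 h1
    have hmem : (1 - t) • x + t • y ∈ X :=
      hF.1 hx.1 hy (by linarith) h0.le (by ring)
    have h2 := hF.2 hx.1 hy (by linarith : 0 ≤ 1 - t) h0.le (by ring)
    have h3 : inner ℝ z ((1 - t) • x + t • y) - F ((1 - t) • x + t • y) ≤ inner ℝ z x - F x :=
      hx.2 hmem
    rw [inner_add_right, real_inner_smul_right, real_inner_smul_right] at h3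
    rw [norm_sub_rev] at h2
    simp only [smul_eq_mul] at h2
    have h4 : t * (inner ℝ z y - F y + (1 - t) * Q) ≤ t * (inner ℝ z x - F x) := by
      rw [hQ]
      nlinarith
    exact le_of_mul_le_mul_left h4 h0
  refine le_of_forall_pos_le_add fun e he => ?_
  by_cases hQ0 : Q ≤ 0
  · have := key (1 / 2) (by norm_num) (by norm_num)
    nlinarith
  · push Not at hQ0
    have ht : 0 < min (1 / 2) (e / Q) := by positivity
    have h1 := key _ ht ((min_le_left _ _).trans_lt (by norm_num))
    have h2 : min (1 / 2) (e / Q) * Q ≤ e := by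
      have := mul_le_mul_of_nonneg_right (min_le_right (1 / 2) (e / Q)) hQ0.le
      rwa [div_mul_cancel₀ _ hQ0.ne'] at this
    linarith

/-- Adding the two growth inequalities gives strong monotonicity, `μ‖x - x'‖² ≤ ⟨z - z', x - x'⟩`;
Cauchy–Schwarz finishes. -/
theorem IsPrimalOf.mul_norm_sub_le {m n : ℕ} {X : Set (Vec m n)} {F : Vec m n → ℝ} {μ : ℝ}
    (hF : StrongConvexOn X μ F) {z z' x x' : Vec m n} (hx : IsPrimalOf X F z x)
    (hx' : IsPrimalOf X F z' x') : μ * ‖x - x'‖ ≤ ‖z - z'‖ := by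
  have h1 := hx.quadratic_growth hF hx'.1
  have h2 := hx'.quadratic_growth hF hx.1
  rw [norm_sub_rev] at h1
  have h3 : μ * ‖x - x'‖ ^ 2 ≤ inner ℝ (z - z') (x - x') := by
    rw [inner_sub_left, inner_sub_right, inner_sub_right]
    linarith
  have h4 := real_inner_le_norm (z - z') (x - x')
  by_contra! hlt
  have : 0 < ‖x - x'‖ := by
    by_contra! h0
    have : ‖x - x'‖ = 0 := le_antisymm h0 (norm_nonneg _)
    rw [this, mul_zero] at hlt
    exact absurd hlt (norm_nonneg _).not_gt
  nlinarith

/-- A convex function with `L`-Lipschitz gradient field `g`. -/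
structure IsSmoothConvex {H : Type*} [NormedAddCommGroup H] [InnerProductSpace ℝ H]
    (L : ℝ) (f : H → ℝ) (g : H → H) : Prop where
  lower : ∀ x y, f x + inner ℝ (g x) (y - x) ≤ f y
  upper : ∀ x y, f y ≤ f x + inner ℝ (g x) (y - x) + L / 2 * ‖y - x‖ ^ 2
  lipschitz : ∀ x y, ‖g x - g y‖ ≤ L * ‖x - y‖

/-- The first-order remainder is squeezed between `0` and `(L/2)‖y - x‖²`. -/
theorem IsSmoothConvex.hasGradientAt {H : Type*} [NormedAddCommGroup H] [InnerProductSpace ℝ H]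
    [CompleteSpace H] {L : ℝ} {f : H → ℝ} {g : H → H} (h : IsSmoothConvex L f g) (x : H) :
    HasGradientAt f (g x) x := by
  rw [hasGradientAt_iff_isLittleO]
  have hO : (fun y => f y - f x - inner ℝ (g x) (y - x)) =O[nhds x] fun y => ‖y - x‖ ^ 2 := by
    refine Asymptotics.IsBigO.of_bound (L / 2) (Filter.Eventually.of_forall fun y => ?_)
    rw [Real.norm_of_nonneg (by linarith [h.lower x y]), Real.norm_of_nonneg (by positivity)]
    linarith [h.upper x y]
  refine hO.trans_isLittleO ?_
  have := (Asymptotics.isLittleO_pow_sub_sub (E' := H) x (m := 2) (by norm_num))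
  exact this

theorem IsPrimalOf.inner_sub_eq_dualObj {m n : ℕ} {W : Mat m n} {X : Set (Vec m n)}
    {F : Vec m n → ℝ} {η x : Vec m n} (hx : IsPrimalOf X F (sqrtOp W η) x) :
    dualObj W X F η = inner ℝ (sqrtOp W η) x - F x := by
  unfold dualObj
  apply le_antisymm
  · have : Nonempty X := ⟨⟨x, hx.1⟩⟩
    refine ciSup_le fun y => ?_
    rw [← inner_sqrtOp]
    exact hx.2 y.2
  · have hb : BddAbove (Set.range fun y : X => inner ℝ η (sqrtOp W (y : Vec m n)) - F y) := by
      refine ⟨inner ℝ (sqrtOp W η) x - F x, ?_⟩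
      rintro _ ⟨y, rfl⟩
      simp only [← inner_sqrtOp]
      exact hx.2 y.2
    rw [inner_sqrtOp]
    exact le_ciSup hb ⟨x, hx.1⟩

theorem isPrimalOf_primalOf {m n : ℕ} {X : Set (Vec m n)} {F : Vec m n → ℝ} {z : Vec m n}
    (h : ∃ x, IsPrimalOf X F z x) : IsPrimalOf X F z (primalOf X F z) :=
  Classical.epsilon_spec h

theorem continuous_primalOf {m n : ℕ} {W : Mat m n} {X : Set (Vec m n)} {F : Vec m n → ℝ} {μ : ℝ}
    (hμ : 0 < μ) (hF : StrongConvexOn X μ F)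
    (hmax : ∀ η, ∃ x, IsPrimalOf X F (sqrtOp W η) x) :
    Continuous fun η => primalOf X F (sqrtOp W η) := by
  have : LipschitzWith (μ⁻¹ * ‖sqrtOp W‖).toNNReal fun η => primalOf X F (sqrtOp W η) :=
    LipschitzWith.of_dist_le_mul fun η η' => by
      rw [dist_eq_norm, dist_eq_norm, Real.coe_toNNReal _ (by positivity), mul_assoc,
        ← div_eq_inv_mul, le_div_iff₀' hμ]
      refine ((isPrimalOf_primalOf (hmax η)).mul_norm_sub_le hF
        (isPrimalOf_primalOf (hmax η'))).trans ?_
      rw [← map_sub]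
      exact (sqrtOp W).le_opNorm _
  exact this.continuous

/-- Conjugate duality: the lower bound holds because the maximizer at `η` competes at `η'`, the
upper bound by quadratic growth and Young's inequality. The Lipschitz bound uses `‖√W‖ ≤ √λ_max(W)`
on both sides of the `1/μ`-Lipschitz argmax map. -/
theorem isSmoothConvex_dualObj {m n : ℕ} {W : Mat m n} (hW : W.PosSemidef) {X : Set (Vec m n)}
    {F : Vec m n → ℝ} {μ : ℝ} (hμ : 0 < μ) (hF : StrongConvexOn X μ F)
    (hmax : ∀ η, ∃ x, IsPrimalOf X F (sqrtOp W η) x) (hL : 0 ≤ lambdaMax W) :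
    IsSmoothConvex (lambdaMax W / μ) (dualObj W X F)
      (fun η => sqrtOp W (primalOf X F (sqrtOp W η))) := by
  have hx := fun η => isPrimalOf_primalOf (hmax η)
  refine ⟨fun η η' => ?_, fun η η' => ?_, fun η η' => ?_⟩
  · rw [(hx η).inner_sub_eq_dualObj, (hx η').inner_sub_eq_dualObj,
      inner_sqrtOp_comm W _ (η' - η), map_sub, inner_sub_left]
    have : inner ℝ (sqrtOp W η') (primalOf X F (sqrtOp W η)) - F (primalOf X F (sqrtOp W η)) ≤
        inner ℝ (sqrtOp W η') (primalOf X F (sqrtOp W η')) - F (primalOf X F (sqrtOp W η')) :=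
      (hx η').2 (hx η).1
    linarith
  · rw [(hx η).inner_sub_eq_dualObj, (hx η').inner_sub_eq_dualObj,
      inner_sqrtOp_comm W _ (η' - η)]
    set x := primalOf X F (sqrtOp W η)
    set y := primalOf X F (sqrtOp W η')
    have h1 := (hx η).quadratic_growth hF (hx η').1
    have h2 := norm_sqrtOp_sq_le hW (η' - η)
    have h3 : inner ℝ (sqrtOp W (η' - η)) (y - x) ≤
        lambdaMax W / μ / 2 * ‖η' - η‖ ^ 2 + μ / 2 * ‖y - x‖ ^ 2 := by
      have h4 := real_inner_le_norm (sqrtOp W (η' - η)) (y - x)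
      have h5 : ‖sqrtOp W (η' - η)‖ * ‖y - x‖ ≤
          ‖sqrtOp W (η' - η)‖ ^ 2 / μ / 2 + μ / 2 * ‖y - x‖ ^ 2 := by
        have : 0 ≤ (‖sqrtOp W (η' - η)‖ - μ * ‖y - x‖) ^ 2 / μ / 2 := by positivity
        have h6 : (‖sqrtOp W (η' - η)‖ - μ * ‖y - x‖) ^ 2 / μ / 2 =
          ‖sqrtOp W (η' - η)‖ ^ 2 / μ / 2 + μ / 2 * ‖y - x‖ ^ 2 -
            ‖sqrtOp W (η' - η)‖ * ‖y - x‖ := by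
          field_simp
          ring
        linarith
      have h7 : ‖sqrtOp W (η' - η)‖ ^ 2 / μ / 2 ≤ lambdaMax W / μ / 2 * ‖η' - η‖ ^ 2 := by
        rw [div_mul_eq_mul_div, div_mul_eq_mul_div]
        gcongr
      linarith
    rw [map_sub] at h3 ⊢
    rw [inner_sub_left] at h3 ⊢
    rw [inner_sub_right, inner_sub_right] at h3
    linarith
  · set x := primalOf X F (sqrtOp W η)
    set y := primalOf X F (sqrtOp W η')
    have h5 : μ * ‖x - y‖ ≤ ‖sqrtOp W (η - η')‖ := by
      rw [map_sub]
      exact (hx η).mul_norm_sub_le hF (hx η')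
    have h6 : ∀ u : Vec m n, ‖sqrtOp W u‖ ≤ Real.sqrt (lambdaMax W) * ‖u‖ := fun u => by
      apply le_of_sq_le_sq _ (by positivity)
      rw [mul_pow, Real.sq_sqrt hL]
      exact norm_sqrtOp_sq_le hW u
    rw [← map_sub, div_mul_eq_mul_div, le_div_iff₀ hμ]
    calc ‖sqrtOp W (x - y)‖ * μ ≤ Real.sqrt (lambdaMax W) * ‖x - y‖ * μ := by
          gcongr
          exact h6 _
      _ = Real.sqrt (lambdaMax W) * (μ * ‖x - y‖) := by ring
      _ ≤ Real.sqrt (lambdaMax W) * (Real.sqrt (lambdaMax W) * ‖η - η'‖) := by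
          exact mul_le_mul_of_nonneg_left (h5.trans (h6 _)) (Real.sqrt_nonneg _)
      _ = lambdaMax W * ‖η - η'‖ := by
          rw [← mul_assoc, Real.mul_self_sqrt hL]

/-- A gradient step of length `1/L` would lower `f` by at least `‖g x‖²/(2L)`. -/
theorem IsSmoothConvex.gradient_eq_zero {H : Type*} [NormedAddCommGroup H]
    [InnerProductSpace ℝ H] {L : ℝ} {f : H → ℝ} {g : H → H} (h : IsSmoothConvex L f g)
    (hL : 0 < L) {x : H} (hx : ∀ y, f x ≤ f y) : g x = 0 := by
  have h1 := hx (x - L⁻¹ • g x)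
  have h2 := h.upper x (x - L⁻¹ • g x)
  rw [sub_sub_cancel_left, inner_neg_right, real_inner_smul_right, real_inner_self_eq_norm_sq,
    norm_neg, norm_smul, mul_pow, Real.norm_of_nonneg (by positivity)] at h2
  have h3 : L / 2 * (L⁻¹ ^ 2 * ‖g x‖ ^ 2) = L⁻¹ * ‖g x‖ ^ 2 / 2 := by
    field_simp
  have h4 : L⁻¹ * ‖g x‖ ^ 2 ≤ 0 := by linarith
  have h5 : 0 ≤ L⁻¹ * ‖g x‖ ^ 2 := by positivity
  have h6 : L⁻¹ * ‖g x‖ ^ 2 = 0 := le_antisymm h4 h5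
  simpa [hL.ne'] using h6

/-- The distance of the primal point `x*(√W η)` to the primal optimum is controlled by the
suboptimality of `η` for the dual problem. -/
theorem norm_primalOf_sub_sq_le {m n : ℕ} {W : Mat m n} (hW : W.PosSemidef) {X : Set (Vec m n)}
    {F : Vec m n → ℝ} {μ : ℝ} (hμ : 0 < μ) (hF : StrongConvexOn X μ F)
    (hmax : ∀ η, ∃ x, IsPrimalOf X F (sqrtOp W η) x) (hL : 0 < lambdaMax W)
    {xs ηs : Vec m n} (hxs : IsPrimalOptimum W X F xs) (hηs : IsDualOptimum W X F ηs)
    (η : Vec m n) :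
    μ / 2 * ‖primalOf X F (sqrtOp W η) - xs‖ ^ 2 ≤ dualObj W X F η - dualObj W X F ηs := by
  have hx := fun η => isPrimalOf_primalOf (hmax η)
  -- Stationarity at `ηs` makes its primal point feasible, so `φ(ηs) = -F` there, which is at most
  -- `-F xs`. Only this half of strong duality is needed.
  have hg : sqrtOp W (primalOf X F (sqrtOp W ηs)) = 0 :=
    (isSmoothConvex_dualObj hW hμ hF hmax hL.le).gradient_eq_zero (by positivity) hηs
  have h1 := (hx η).quadratic_growth hF hxs.1.1
  have h2 : F xs ≤ F (primalOf X F (sqrtOp W ηs)) := hxs.2 ⟨(hx ηs).1, hg⟩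
  rw [(hx η).inner_sub_eq_dualObj, (hx ηs).inner_sub_eq_dualObj]
  rw [inner_sqrtOp W η xs, hxs.1.2, inner_zero_right, norm_sub_rev] at h1
  rw [inner_sqrtOp W ηs, hg, inner_zero_right]
  linarith

/-! ### Summation of the expected one-step inequalities -/

/-- The window has length at most `τ + 1 ≤ 2m ≤ 2 t_i`, so growth by `5/8` per step gives the factor
`1 + 2 · 5/8 = 9/4`. -/
theorem recip_le_of_delay {m τ : ℕ} (hτ : 1 ≤ τ) (hm : τ ≤ m) {i k : ℕ} (hik : i ≤ k)
    (hk : k - i ≤ τ + 1) : recip m k ≤ 9 / 4 * recip m i := by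
  have hm1 : 1 ≤ m := hτ.trans hm
  have h1 := recip_add_le hm1 i (k - i)
  rw [Nat.add_sub_cancel' hik] at h1
  have h2 := recip_ge hm1 i
  have h3 : ((k - i : ℕ) : ℝ) ≤ m + m := by exact_mod_cast (by omega : k - i ≤ m + m)
  linarith

/-- Exchange the sums: each `q i` is charged with total delay weight at most `delaySum`, and
replacing `t_k²` by `t_i²` costs `(9/4)² = 81/16`. -/
theorem sum_delayed_le {m τ : ℕ} (hτ : 1 ≤ τ) (hm : τ ≤ m) {q : ℕ → ℝ} (hq : ∀ k, 0 ≤ q k)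
    (K : ℕ) :
    ∑ k ∈ Finset.range K, recip m k ^ 2 * ∑ i ∈ Finset.range k, delayWeight m τ (k - i) * q i ≤
      81 / 16 * delaySum m τ * ∑ i ∈ Finset.range K, recip m i ^ 2 * q i := by
  have hm1 : 1 ≤ m := hτ.trans hm
  calc ∑ k ∈ Finset.range K, recip m k ^ 2 *
        ∑ i ∈ Finset.range k, delayWeight m τ (k - i) * q i
      ≤ ∑ k ∈ Finset.range K, ∑ i ∈ Finset.range k,
        81 / 16 * (recip m i ^ 2 * q i) * delayWeight m τ (k - i) := by
        refine Finset.sum_le_sum fun k _ => ?_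
        rw [Finset.mul_sum]
        refine Finset.sum_le_sum fun i hi => ?_
        have hi' := Finset.mem_range.1 hi
        by_cases hd : k - i ≤ τ + 1
        · have h1 := recip_le_of_delay hτ hm hi'.le hd
          have h2 : recip m k ^ 2 ≤ 81 / 16 * recip m i ^ 2 := by
            have := pow_le_pow_left₀ (recip_pos hm1 k).le h1 2
            linarith
          have h3 := mul_nonneg (delayWeight_nonneg m τ (k - i)) (hq i)
          nlinarith
        · have : delayWeight m τ (k - i) = 0 := by
            unfold delayWeight
            rw [if_neg (by omega), if_neg hd, add_zero]
          simp [this]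
    _ = ∑ i ∈ Finset.range K, ∑ k ∈ Finset.Ico (i + 1) K,
        81 / 16 * (recip m i ^ 2 * q i) * delayWeight m τ (k - i) := by
        apply Finset.sum_comm'
        intro k i
        simp only [Finset.mem_range, Finset.mem_Ico]
        omega
    _ ≤ ∑ i ∈ Finset.range K, 81 / 16 * (recip m i ^ 2 * q i) * delaySum m τ := by
        refine Finset.sum_le_sum fun i _ => ?_
        rw [← Finset.mul_sum, Finset.sum_Ico_eq_sum_range]
        refine mul_le_mul_of_nonneg_left ?_ (by have := hq i; positivity)
        refine le_trans (le_of_eq (Finset.sum_congr rfl fun d _ => ?_))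
          (sum_range_delayWeight_le hm1 τ (K - (i + 1)))
        congr 1
        omega
    _ = _ := by
        rw [Finset.mul_sum]
        exact Finset.sum_congr rfl fun i _ => by ring

/-- Deterministic core of the convergence proof. The sequences stand for expectations: `e` the gap,
`v` the weighted distance of `ζ`, `p` and `q` the squared norms of exact and stochastic gradients,
`r` the stale error, `σ` the variance. -/
theorem sum_step_le {m τ : ℕ} (hτ : 1 ≤ τ) (hm : τ ≤ m) {L γ ε : ℝ} (hL : 0 < L) (hγ : 0 < γ)
    (hε : 0 < ε) (hrate : 3 * L * γ + 12 * L * γ * (((τ : ℝ) ^ 2 + τ) / m + 2 * τ) ^ 2 ≤ 1)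
    {e v p q r σ : ℕ → ℝ} {K : ℕ} (hv : ∀ k, 0 ≤ v k) (hq0 : ∀ k, 0 ≤ q k)
    (hq : ∀ k ≤ K, q k = p k + σ k) (hσ : ∀ k ≤ K, σ k ≤ m * L * theta m (k + 1) * ε / 8)
    (hr : ∀ k ≤ K, r k ≤ γ ^ 2 * delaySum m τ / m *
      ∑ i ∈ Finset.range k, delayWeight m τ (k - i) * q i)
    (hstep : ∀ k ≤ K, recip m k ^ 2 * e (k + 1) + v (k + 1) ≤
      (recip m k ^ 2 - recip m k) * e k + v k + recip m k ^ 2 *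
        (L / 2 * (1 + 2 * (L * γ) / m) * r k +
          γ / (2 * m) * (-(3 / 2) * p k + (1 + L * γ) * q k))) :
    recip m K ^ 2 * e (K + 1) ≤
      ((m : ℝ) ^ 2 - m) * e 0 + v 0 + ε / 2 * recip m K ^ 2 := by
  have hm1 : 1 ≤ m := hτ.trans hm
  have hm1' : (1 : ℝ) ≤ m := by exact_mod_cast hm1
  have hm0 : (0 : ℝ) < m := by linarith
  have hτ1 : (1 : ℝ) ≤ τ := by exact_mod_cast hτ
  set S := delaySum m τ with hS
  have hS0 : 0 ≤ S := delaySum_nonneg m τ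
  set x := L * γ with hx
  have hx0 : 0 < x := mul_pos hL hγ
  have hSx : 3 * x + 12 * x * S ^ 2 ≤ 1 := by
    have h1 := pow_le_pow_left₀ hS0 (delaySum_le hτ hm) 2
    have := mul_le_mul_of_nonneg_left h1 hx0.le
    have h3 : 3 * L * γ + 12 * L * γ * (((τ : ℝ) ^ 2 + τ) / m + 2 * τ) ^ 2 =
      3 * x + 12 * (x * (((τ : ℝ) ^ 2 + τ) / m + 2 * τ) ^ 2) := by rw [hx]; ring
    linarith
  have hx51 : x ≤ 1 / 51 := by
    have h1 : (2 : ℝ) ≤ ((τ : ℝ) ^ 2 + τ) / m + 2 * τ := by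
      have : 0 ≤ ((τ : ℝ) ^ 2 + τ) / m := by positivity
      linarith
    have h2 : (2 : ℝ) ^ 2 ≤ (((τ : ℝ) ^ 2 + τ) / m + 2 * τ) ^ 2 := pow_le_pow_left₀ (by norm_num) h1 2
    have h3 : 3 * L * γ + 12 * L * γ * (((τ : ℝ) ^ 2 + τ) / m + 2 * τ) ^ 2 =
      3 * x + 12 * (x * (((τ : ℝ) ^ 2 + τ) / m + 2 * τ) ^ 2) := by rw [hx]; ring
    have := mul_le_mul_of_nonneg_left h2 hx0.le
    linarith
  set T : ℕ → ℝ := fun k => recip m k ^ 2 *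
        (L / 2 * (1 + 2 * x / m) * r k + γ / (2 * m) * (-(3 / 2) * p k + (1 + x) * q k)) with hT
  have htel : ∀ k ≤ K, recip m k ^ 2 * e (k + 1) + v (k + 1) ≤
      ((m : ℝ) ^ 2 - m) * e 0 + v 0 + ∑ i ∈ Finset.range (k + 1), T i := by
    intro k hk
    induction k with
    | zero =>
      have := hstep 0 hk
      rw [recip_zero] at this
      simpa [hT, recip_zero] using this
    | succ k ih =>
      have h1 := ih (by omega)
      have h2 := hstep (k + 1) hk
      rw [recip_succ hm1 k] at h2
      rw [Finset.sum_range_succ]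
      simp only [hT] at h1 ⊢
      linarith
  have hdelay : ∑ k ∈ Finset.range (K + 1), recip m k ^ 2 * r k ≤
      γ ^ 2 * S / m * (81 / 16 * S * ∑ i ∈ Finset.range (K + 1), recip m i ^ 2 * q i) := by
    refine le_trans ?_ (mul_le_mul_of_nonneg_left (sum_delayed_le hτ hm hq0 (K + 1))
      (by positivity))
    rw [Finset.mul_sum]
    refine Finset.sum_le_sum fun k hk => ?_
    have := hr k (by simpa [Nat.lt_succ_iff] using hk)
    exact (mul_le_mul_of_nonneg_left this (sq_nonneg (recip m k))).trans_eq (by ring)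
  -- The bound `1/2 - x` is what is needed: together with `1 + x` it gives `3/2`, which matches the
  -- negative coefficient of `p`.
  have hcoef : x * S ^ 2 * (81 / 16) * (1 + 2 * x / m) ≤ 1 / 2 - x := by
    have h1 : 2 * x / m ≤ 2 * x := div_le_self (by positivity) hm1'
    have h2 : x * S ^ 2 ≤ (1 - 3 * x) / 12 := by linarith
    have h3 : x * S ^ 2 * (81 / 16) * (1 + 2 * x / m) ≤
        (1 - 3 * x) / 12 * (81 / 16) * (1 + 2 * x) := by
      have : 0 ≤ 1 - 3 * x := by linarith
      gcongr
    nlinarith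
  have hTsum : ∑ k ∈ Finset.range (K + 1), T k ≤ ε / 2 * recip m K ^ 2 := by
    have h1 : ∑ k ∈ Finset.range (K + 1), T k =
        L / 2 * (1 + 2 * x / m) * ∑ k ∈ Finset.range (K + 1), recip m k ^ 2 * r k +
        ∑ k ∈ Finset.range (K + 1), recip m k ^ 2 *
          (γ / (2 * m) * (-(3 / 2) * p k + (1 + x) * q k)) := by
      rw [Finset.mul_sum, ← Finset.sum_add_distrib]
      exact Finset.sum_congr rfl fun k _ => by simp only [hT]; ring
    have h2 := mul_le_mul_of_nonneg_left hdelay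
      (by positivity : 0 ≤ L / 2 * (1 + 2 * x / m))
    have h3 : L / 2 * (1 + 2 * x / m) * (γ ^ 2 * S / m *
        (81 / 16 * S * ∑ i ∈ Finset.range (K + 1), recip m i ^ 2 * q i)) =
        ∑ i ∈ Finset.range (K + 1), recip m i ^ 2 *
          (γ / (2 * m) * ((x * S ^ 2 * (81 / 16) * (1 + 2 * x / m)) * q i)) := by
      rw [Finset.mul_sum, Finset.mul_sum, Finset.mul_sum]
      refine Finset.sum_congr rfl fun k _ => ?_
      rw [hx]
      field_simp
    rw [h1]
    refine (add_le_add_left (h2.trans_eq h3) _).trans ?_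
    rw [← Finset.sum_add_distrib]
    have h4 : ∀ k ∈ Finset.range (K + 1), recip m k ^ 2 *
          (γ / (2 * m) * ((x * S ^ 2 * (81 / 16) * (1 + 2 * x / m)) * q k)) +
        recip m k ^ 2 * (γ / (2 * m) * (-(3 / 2) * p k + (1 + x) * q k)) ≤
        ε / 2 * recip m k := by
      intro k hk
      have hk' : k ≤ K := by simpa [Nat.lt_succ_iff] using hk
      have ha := mul_le_mul_of_nonneg_right hcoef (hq0 k)
      -- As `q = p + σ`, the `p` terms cancel and only `(3/2) σ` survives.
      have hb : (x * S ^ 2 * (81 / 16) * (1 + 2 * x / m)) * q k +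
          (-(3 / 2) * p k + (1 + x) * q k) ≤ 3 / 2 * (m * L * theta m (k + 1) * ε / 8) := by
        have := hσ k hk'
        have := hq k hk'
        linarith
      have hc : recip m k ^ 2 * (γ / (2 * m)) * (3 / 2 * (m * L * theta m (k + 1) * ε / 8)) =
          3 / 32 * x * ε * recip m k := by
        have : recip m k ^ 2 * (γ / (2 * m)) * (3 / 2 * (m * L * theta m (k + 1) * ε / 8)) =
            3 / 32 * x * ε * recip m k * (recip m k * theta m (k + 1)) := by
          rw [hx]
          field_simp
          ring
        rw [this, recip_mul_theta hm1 k, mul_one]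
      have hd : 0 ≤ recip m k ^ 2 * (γ / (2 * m)) := by positivity
      have he := mul_le_mul_of_nonneg_left hb hd
      have hf : 3 / 32 * x * ε * recip m k ≤ ε / 2 * recip m k := by
        refine mul_le_mul_of_nonneg_right ?_ (recip_pos hm1 k).le
        nlinarith
      linarith
    refine (Finset.sum_le_sum h4).trans ?_
    rw [← Finset.mul_sum]
    exact mul_le_mul_of_nonneg_left (sum_recip_le hm1 K) (by positivity)
  have := htel K le_rfl
  have := hv (K + 1)
  linarith

/-- The initial terms are at most `m² d²/γ`, and the lower rate bound gives `1/γ ≤ 195 L τ²/c`. With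
`t_K² ≥ K²/4`, the constant `40` yields `1600/4 = 400 ≥ 2 · 195`, so they use at most `ε/2`; the
variance uses the other half. -/
theorem final_bound {m τ : ℕ} (hτ : 1 ≤ τ) (hm : τ ≤ m) {c L γ ε d e0 eK : ℝ} (hc : 0 < c)
    (hL : 0 < L) (hγ : 0 < γ) (hε : 0 < ε) (hd : 0 ≤ d)
    (hrate : 3 * L * γ + 12 * L * γ * (((τ : ℝ) ^ 2 + τ) / m + 2 * τ) ^ 2 ≤ 1)
    (hrate' : c ≤ 3 * L * γ + 12 * L * γ * (((τ : ℝ) ^ 2 + τ) / m + 2 * τ) ^ 2) {K : ℕ}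
    (hK : 40 / Real.sqrt c * (m * τ * Real.sqrt L / Real.sqrt ε * d) ≤ K)
    (he0 : e0 ≤ L / 2 * d ^ 2)
    (h : recip m K ^ 2 * eK ≤
      ((m : ℝ) ^ 2 - m) * e0 + m ^ 2 / (2 * γ) * d ^ 2 + ε / 2 * recip m K ^ 2) :
    eK ≤ ε := by
  have hm1 : 1 ≤ m := hτ.trans hm
  have hm1' : (1 : ℝ) ≤ m := by exact_mod_cast hm1
  have hm0 : (0 : ℝ) < m := by linarith
  have hτ1 : (1 : ℝ) ≤ τ := by exact_mod_cast hτ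
  have hτm : (τ : ℝ) ≤ m := by exact_mod_cast hm
  have hD : ((τ : ℝ) ^ 2 + τ) / m + 2 * τ ≤ 4 * τ := by
    have : ((τ : ℝ) ^ 2 + τ) / m ≤ 2 * τ := by
      rw [div_le_iff₀ hm0]
      nlinarith
    linarith
  have hD2 : (((τ : ℝ) ^ 2 + τ) / m + 2 * τ) ^ 2 ≤ 16 * τ ^ 2 := by
    have := pow_le_pow_left₀ (by positivity) hD 2
    linarith
  have hLγ : 0 < L * γ := mul_pos hL hγ
  have h1 : c ≤ 195 * (L * γ) * τ ^ 2 := by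
    have h2 := mul_le_mul_of_nonneg_left hD2 hLγ.le
    have h3 : (1 : ℝ) ≤ τ ^ 2 := by nlinarith
    have h4 := mul_le_mul_of_nonneg_left h3 hLγ.le
    linarith
  have h2 : L * γ ≤ 1 := by
    have : 0 ≤ 12 * L * γ * (((τ : ℝ) ^ 2 + τ) / m + 2 * τ) ^ 2 := by positivity
    linarith
  have hc1 : c ≤ 1 := hrate'.trans hrate
  have h3 : (1 : ℝ) / γ ≤ 195 * L * τ ^ 2 / c := by
    rw [div_le_div_iff₀ hγ hc]
    linarith
  have h4 : L ≤ 1 / γ := by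
    rw [le_div_iff₀ hγ]
    exact h2
  set N : ℝ := m * τ * d with hN
  have h5 : ((m : ℝ) ^ 2 - m) * e0 + m ^ 2 / (2 * γ) * d ^ 2 ≤ 195 * L / c * N ^ 2 := by
    have ha : ((m : ℝ) ^ 2 - m) * e0 ≤ (m ^ 2 - m) * (L / 2 * d ^ 2) :=
      mul_le_mul_of_nonneg_left he0 (by nlinarith)
    have hb : (0 : ℝ) ≤ m * (L / 2 * d ^ 2) := by positivity
    have hc' : (m : ℝ) ^ 2 / (2 * γ) * d ^ 2 = 1 / γ * (m ^ 2 * d ^ 2 / 2) := by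
      field_simp
    have hd' : L * ((m : ℝ) ^ 2 * d ^ 2 / 2) ≤ 1 / γ * (m ^ 2 * d ^ 2 / 2) := by gcongr
    have he : 1 / γ * ((m : ℝ) ^ 2 * d ^ 2) ≤ 195 * L * τ ^ 2 / c * (m ^ 2 * d ^ 2) := by gcongr
    have hf : 195 * L * τ ^ 2 / c * ((m : ℝ) ^ 2 * d ^ 2) = 195 * L / c * N ^ 2 := by
      rw [hN]
      ring
    linarith
  have h6 : 1600 / c * (L / ε * N ^ 2) ≤ (K : ℝ) ^ 2 := by
    have ha := pow_le_pow_left₀ (by positivity) hK 2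
    have hb : (40 / Real.sqrt c * (m * τ * Real.sqrt L / Real.sqrt ε * d)) ^ 2 =
        1600 / Real.sqrt c ^ 2 * (Real.sqrt L ^ 2 / Real.sqrt ε ^ 2 * N ^ 2) := by
      rw [hN]
      ring
    rwa [hb, Real.sq_sqrt hc.le, Real.sq_sqrt hL.le, Real.sq_sqrt hε.le] at ha
  have h7 := pow_le_pow_left₀ (by positivity) (half_le_recip hm1 K) 2
  have h8 : 1600 * (L / c * N ^ 2) ≤ 4 * recip m K ^ 2 * ε := by
    have ha : 1600 / c * (L / ε * N ^ 2) * ε = 1600 * (L / c * N ^ 2) := by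
      field_simp
    rw [← ha]
    refine mul_le_mul_of_nonneg_right ?_ hε.le
    linarith
  have h9 : 0 < recip m K ^ 2 := pow_pos (recip_pos hm1 K) 2
  refine le_of_mul_le_mul_left ?_ h9
  have h10 : 0 ≤ L / c * N ^ 2 := by positivity
  have h11 : 195 * L / c * N ^ 2 = 195 * (L / c * N ^ 2) := by ring
  linarith

/-! ### Averaging over the draws of one iteration -/

section Draws

variable {Ω β 𝒳 𝒴 : Type*} {mΩ : MeasurableSpace Ω} [MeasurableSpace β] [MeasurableSpace 𝒳]
  [MeasurableSpace 𝒴] {P : Measure Ω} {b : Ω → β} {x : Ω → 𝒳} {Y : Ω → 𝒴}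

/-- The hypotheses make the joint law of `(b, x, Y)` a triple product, which may be reassociated. -/
theorem indepFun_prodMk_of_indepFun [IsProbabilityMeasure P] (hb : Measurable b) (hx : Measurable x) (hY : Measurable Y)
    (hbx : IndepFun b x P) (h : IndepFun (fun s => (b s, x s)) Y P) :
    IndepFun b (fun s => (x s, Y s)) P := by
  have hxY : IndepFun x Y P := h.comp (φ := Prod.snd) (ψ := id) measurable_snd measurable_id
  have : IsProbabilityMeasure (P.map b) := Measure.isProbabilityMeasure_map hb.aemeasurable
  have : IsProbabilityMeasure (P.map x) := Measure.isProbabilityMeasure_map hx.aemeasurable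
  have : IsProbabilityMeasure (P.map Y) := Measure.isProbabilityMeasure_map hY.aemeasurable
  rw [indepFun_iff_map_prod_eq_prod_map_map hb.aemeasurable (hx.prodMk hY).aemeasurable,
    (indepFun_iff_map_prod_eq_prod_map_map hx.aemeasurable hY.aemeasurable).1 hxY,
    ← (measurePreserving_prodAssoc (P.map b) (P.map x) (P.map Y)).map_eq,
    ← (indepFun_iff_map_prod_eq_prod_map_map hb.aemeasurable hx.aemeasurable).1 hbx,
    ← (indepFun_iff_map_prod_eq_prod_map_map (hb.prodMk hx).aemeasurable hY.aemeasurable).1 h,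
    Measure.map_map (MeasurableEquiv.measurable _) ((hb.prodMk hx).prodMk hY)]
  rfl

/-- Split according to the drawn value; each indicator is independent of `Y` and has probability
`1/m`. -/
theorem integral_uniform_draw {m : ℕ} {b : Ω → Fin m} (hb : Measurable b)
    (hlaw : P.map b = uniformOn (Set.univ : Set (Fin m)))
    (h : IndepFun b Y P) {Φ : Fin m → 𝒴 → ℝ} (hΦ : ∀ i, Measurable (Φ i))
    (hint : ∀ i, Integrable (fun s => Φ i (Y s)) P) :
    ∫ s, Φ (b s) (Y s) ∂P = (m : ℝ)⁻¹ * ∑ i, ∫ s, Φ i (Y s) ∂P := by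
  set I : Fin m → Fin m → ℝ := fun i j => if j = i then 1 else 0 with hI
  have hIm : ∀ i, Measurable fun s => I i (b s) := fun i => (measurable_of_countable (I i)).comp hb
  have h1 : ∀ s, Φ (b s) (Y s) = ∑ i, I i (b s) * Φ i (Y s) := by
    intro s
    simp [hI]
  have h2 : ∀ i, Integrable (fun s => I i (b s) * Φ i (Y s)) P := by
    intro i
    refine (hint i).bdd_mul (c := 1) (hIm i).aestronglyMeasurable
      (Filter.Eventually.of_forall fun s => ?_)
    by_cases hs : b s = i <;> simp [hI, hs]
  simp_rw [h1]
  rw [integral_finsetSum _ fun i _ => h2 i, Finset.mul_sum]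
  refine Finset.sum_congr rfl fun i _ => ?_
  have h3 : IndepFun (fun s => I i (b s)) (fun s => Φ i (Y s)) P :=
    h.comp (measurable_of_countable (I i)) (hΦ i)
  rw [h3.integral_fun_mul_eq_mul_integral (hIm i).aestronglyMeasurable
    (hint i).aestronglyMeasurable]
  congr 1
  have h4 : (fun s => I i (b s)) = Set.indicator (b ⁻¹' {i}) (1 : Ω → ℝ) := by
    ext s
    by_cases hs : b s = i
    · rw [Set.indicator_of_mem (show s ∈ b ⁻¹' {i} from hs)]
      simp [hI, hs]
    · rw [Set.indicator_of_notMem (show s ∉ b ⁻¹' {i} from hs)]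
      simp [hI, hs]
  rw [h4, integral_indicator_one (hb (measurableSet_singleton i)), measureReal_def,
    ← Measure.map_apply hb (measurableSet_singleton i), hlaw, uniformOn_univ]
  simp

end Draws

/-! ### Mini-batch gradients as unbiased estimates. -/

section Gradient

variable {m n : ℕ} {Ξ : Type*} [MeasurableSpace Ξ] {φ : Vec m n → ℝ} {ϕ : Vec m n → Ξ → ℝ}
  {ν : Measure Ξ}

theorem IsStochasticOracle.measurable_batchGradient (h : IsStochasticOracle φ ϕ ν) (M : ℕ) :
    Measurable fun q : (Fin M → Ξ) × Vec m n => batchGradient ϕ q.1 q.2 := by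
  have h1 : ∀ r : Fin M, Measurable fun q : (Fin M → Ξ) × Vec m n =>
      gradient (fun η' => ϕ η' (q.1 r)) q.2 := fun r => h.measurable_gradient.comp
    (measurable_snd.prodMk ((measurable_pi_apply r).comp measurable_fst))
  have h2 : Measurable fun q : (Fin M → Ξ) × Vec m n =>
      ∑ r, gradient (fun η' => ϕ η' (q.1 r)) q.2 := Finset.measurable_sum _ fun r _ => h1 r
  exact h2.const_smul (M : ℝ)⁻¹

theorem IsStochasticOracle.measurable_inner_batchGradient (h : IsStochasticOracle φ ϕ ν) (M : ℕ) :
    Measurable fun q : (Vec m n × Vec m n) × (Fin M → Ξ) =>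
      (inner ℝ q.1.2 (batchGradient ϕ q.2 q.1.1) : ℝ) := by
  have h1 : Measurable fun q : (Vec m n × Vec m n) × (Fin M → Ξ) => (q.2, q.1.1) :=
    measurable_snd.prodMk (measurable_fst.comp measurable_fst)
  have h2 : Measurable fun q : (Vec m n × Vec m n) × (Fin M → Ξ) => q.1.2 :=
    measurable_snd.comp measurable_fst
  have h3 := (h.measurable_batchGradient M).comp h1
  exact Measurable.inner (𝕜 := ℝ) h2 h3

variable [IsProbabilityMeasure ν]

theorem IsStochasticOracle.integrable_gradient_eval (h : IsStochasticOracle φ ϕ ν) {M : ℕ}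
    (η : Vec m n) (r : Fin M) :
    Integrable (fun ξ : Fin M → Ξ => gradient (fun η' => ϕ η' (ξ r)) η)
      (Measure.pi fun _ : Fin M => ν) :=
  (measurePreserving_eval (fun _ : Fin M => ν) r).integrable_comp_of_integrable
    (h.integrable_gradient η)

theorem IsStochasticOracle.integrable_batchGradient (h : IsStochasticOracle φ ϕ ν) {M : ℕ}
    (η : Vec m n) :
    Integrable (fun ξ => batchGradient ϕ ξ η) (Measure.pi fun _ : Fin M => ν) := by
  have h1 := integrable_finsetSum Finset.univ fun (r : Fin M) _ => h.integrable_gradient_eval η r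
  exact h1.smul (M : ℝ)⁻¹

theorem IsStochasticOracle.integral_batchGradient (h : IsStochasticOracle φ ϕ ν) {M : ℕ}
    (hM : 1 ≤ M) (η : Vec m n) :
    ∫ ξ, batchGradient ϕ ξ η ∂(Measure.pi fun _ : Fin M => ν) = gradient φ η := by
  have hp := measurePreserving_eval fun _ : Fin M => ν
  have h1 : ∀ r : Fin M, ∫ ξ : Fin M → Ξ, gradient (fun η' => ϕ η' (ξ r)) η
      ∂(Measure.pi fun _ : Fin M => ν) = gradient φ η := by
    intro r
    have h2 : AEStronglyMeasurable (fun ξ => gradient (fun η' => ϕ η' ξ) η)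
        (Measure.map (Function.eval r) (Measure.pi fun _ : Fin M => ν)) := by
      rw [(hp r).map_eq]
      exact (h.integrable_gradient η).aestronglyMeasurable
    have h3 := integral_map (hp r).measurable.aemeasurable h2
    rw [(hp r).map_eq, h.integral_gradient η] at h3
    exact h3.symm
  unfold batchGradient
  rw [integral_smul, integral_finsetSum _ fun r _ => h.integrable_gradient_eval η r]
  simp_rw [h1]
  have : (M : ℝ) ≠ 0 := by positivity
  simp [← Nat.cast_smul_eq_nsmul ℝ, smul_smul, this]

variable {Ω : Type*} {mΩ : MeasurableSpace Ω} {P : Measure Ω} [IsProbabilityMeasure P]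

/-- Fubini on the product of the law of `(om, U)` and that of the batch: with the former frozen, the
batch gradient has mean `∇φ(om)`. -/
theorem IsStochasticOracle.integral_inner_batchGradient (h : IsStochasticOracle φ ϕ ν) {M : ℕ}
    (hM : 1 ≤ M) {ξ : Ω → Fin M → Ξ} (hξ : Measurable ξ)
    (hlaw : P.map ξ = Measure.pi fun _ => ν) {U om : Ω → Vec m n} (hU : Measurable U)
    (hom : Measurable om) (hind : IndepFun ξ (fun s => (om s, U s)) P)
    (hint : Integrable (fun s => inner ℝ (U s) (batchGradient ϕ (ξ s) (om s))) P) :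
    ∫ s, inner ℝ (U s) (batchGradient ϕ (ξ s) (om s)) ∂P =
      ∫ s, inner ℝ (U s) (gradient φ (om s)) ∂P := by
  set Y : Ω → Vec m n × Vec m n := fun s => (om s, U s) with hY
  have hYm : Measurable Y := hom.prodMk hU
  have hj : P.map (fun s => (Y s, ξ s)) = (P.map Y).prod (Measure.pi fun _ => ν) := by
    rw [← hlaw]
    exact (indepFun_iff_map_prod_eq_prod_map_map hYm.aemeasurable hξ.aemeasurable).1 hind.symm
  let f : (Vec m n × Vec m n) × (Fin M → Ξ) → ℝ :=
    fun q => inner ℝ q.1.2 (batchGradient ϕ q.2 q.1.1)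
  have hfm : Measurable f := h.measurable_inner_batchGradient M
  have hYξ : Measurable fun s => (Y s, ξ s) := hYm.prodMk hξ
  have hfi : Integrable f ((P.map Y).prod (Measure.pi fun _ => ν)) := by
    rw [← hj, integrable_map_measure hfm.aestronglyMeasurable hYξ.aemeasurable]
    exact hint
  have : IsProbabilityMeasure (P.map Y) := Measure.isProbabilityMeasure_map hYm.aemeasurable
  calc ∫ s, inner ℝ (U s) (batchGradient ϕ (ξ s) (om s)) ∂P
      = ∫ q, f q ∂(P.map fun s => (Y s, ξ s)) :=
        (integral_map hYξ.aemeasurable hfm.aestronglyMeasurable).symm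
    _ = ∫ y, ∫ z, f (y, z) ∂(Measure.pi fun _ => ν) ∂(P.map Y) := by
        rw [hj, integral_prod _ hfi]
    _ = ∫ y : Vec m n × Vec m n, inner ℝ y.2 (gradient φ y.1) ∂(P.map Y) := by
        refine integral_congr_ae (Filter.Eventually.of_forall fun y => ?_)
        simp only [f]
        rw [integral_inner (h.integrable_batchGradient y.1), h.integral_batchGradient hM]
    _ = ∫ s, inner ℝ (U s) (gradient φ (om s)) ∂P := by
        rw [integral_map hYm.aemeasurable]
        have : (fun y : Vec m n × Vec m n => (inner ℝ y.2 (gradient φ y.1) : ℝ)) =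
            fun y => ∫ z, f (y, z) ∂(Measure.pi fun _ => ν) := by
          ext y
          simp only [f]
          rw [integral_inner (h.integrable_batchGradient y.1), h.integral_batchGradient hM]
        rw [this]
        exact hfi.integral_prod_left.aestronglyMeasurable

end Gradient

/-! ### Blocks -/

/-- The vector whose `b`-th block is that of `g`, and whose other blocks vanish. -/
def blockPart {m n : ℕ} (b : Fin m) (g : Vec m n) : Vec m n :=
  WithLp.toLp 2 fun c => if c.1 = b then g c else 0

theorem blockStep_eq {m n : ℕ} (s : ℝ) (b : Fin m) (g : Vec m n) :
    blockStep s b g = -(s • blockPart b g) := by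
  ext c
  simp only [blockStep, blockPart, PiLp.neg_apply, PiLp.smul_apply, smul_eq_mul]
  split_ifs <;> simp

theorem sum_blockPart {m n : ℕ} (g : Vec m n) : ∑ b, blockPart b g = g := by
  ext c
  simp [blockPart]

theorem inner_blockPart_self {m n : ℕ} (b : Fin m) (g : Vec m n) :
    inner ℝ g (blockPart b g) = ‖blockPart b g‖ ^ 2 := by
  rw [← real_inner_self_eq_norm_sq, PiLp.inner_apply, PiLp.inner_apply]
  refine Finset.sum_congr rfl fun c _ => ?_
  simp only [blockPart]
  split_ifs <;> simp

theorem sum_norm_blockPart_sq {m n : ℕ} (g : Vec m n) :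
    ∑ b, ‖blockPart b g‖ ^ 2 = ‖g‖ ^ 2 := by
  simp_rw [← inner_blockPart_self]
  rw [← inner_sum, sum_blockPart, real_inner_self_eq_norm_sq]

theorem norm_blockPart_le {m n : ℕ} (b : Fin m) (g : Vec m n) : ‖blockPart b g‖ ≤ ‖g‖ := by
  apply le_of_sq_le_sq _ (norm_nonneg g)
  rw [← sum_norm_blockPart_sq g]
  exact Finset.single_le_sum (f := fun b => ‖blockPart b g‖ ^ 2) (fun _ _ => sq_nonneg _)
    (Finset.mem_univ b)

theorem measurable_blockPart {m n : ℕ} :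
    Measurable fun q : Fin m × Vec m n => blockPart q.1 q.2 := by
  refine measurable_from_prod_countable_right fun b => ?_
  refine (WithLp.measurable_toLp 2 _).comp (measurable_pi_lambda _ fun c => ?_)
  by_cases h : c.1 = b
  · simp only [h, if_true]
    fun_prop
  · simp only [h, if_false]
    fun_prop

/-! ### One iteration along a sample path -/

theorem zetaSeq_succ_eq {m n : ℕ} (γ : ℝ) (η₀ : Vec m n) (j : ℕ → Fin m → ℕ) (b : ℕ → Fin m)
    (g : ℕ → Vec m n → Vec m n) (k : ℕ) :
    zetaSeq γ η₀ j b g (k + 1) = zetaSeq γ η₀ j b g k -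
      (γ / (m * theta m (k + 1))) • blockPart (b k) (g k (omegaSeq γ η₀ j b g k)) := by
  rw [zetaSeq_succ, blockStep_eq, sub_eq_add_neg]

theorem mul_zetaSeq_sub {m n : ℕ} (hm : 1 ≤ m) (γ : ℝ) (η₀ : Vec m n) (j : ℕ → Fin m → ℕ)
    (b : ℕ → Fin m) (g : ℕ → Vec m n → Vec m n) (k : ℕ) :
    ((m : ℝ) * theta m (k + 1)) • (zetaSeq γ η₀ j b g (k + 1) - zetaSeq γ η₀ j b g k) =
      -(γ • blockPart (b k) (g k (omegaSeq γ η₀ j b g k))) := by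
  have h1 := (theta_pos hm k).ne'
  have h2 : (m : ℝ) ≠ 0 := by positivity
  rw [zetaSeq_succ_eq, sub_sub_cancel_left, smul_neg, smul_smul]
  congr 2
  field_simp

theorem etaSeq_succ_eq {m n : ℕ} (hm : 1 ≤ m) (γ : ℝ) (η₀ : Vec m n) (j : ℕ → Fin m → ℕ)
    (b : ℕ → Fin m) (g : ℕ → Vec m n → Vec m n) (k : ℕ) :
    etaSeq γ η₀ j b g (k + 1) = lamSeq γ η₀ j b g (k + 1) -
      γ • blockPart (b k) (g k (omegaSeq γ η₀ j b g k)) := by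
  rw [etaSeq_succ, mul_zetaSeq_sub hm, sub_eq_add_neg]

/-- The distance between `λ_{k+1}` and the compensated stale point is controlled by the block
updates of the last `τ + 1` iterations. -/
theorem norm_lamSeq_sub_omegaSeq_sq_le {m n τ : ℕ} (hm : 1 ≤ m) (γ : ℝ) (η₀ : Vec m n)
    (j : ℕ → Fin m → ℕ) (b : ℕ → Fin m) (g : ℕ → Vec m n → Vec m n) (k : ℕ)
    (hj : ∀ p, j k p ≤ k) (hτ : ∀ p, k ≤ j k p + τ) :
    ‖lamSeq γ η₀ j b g (k + 1) - omegaSeq γ η₀ j b g k‖ ^ 2 ≤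
      γ ^ 2 * delaySum m τ * ∑ i ∈ Finset.range k, delayWeight m τ (k - i) *
        ‖blockPart (b i) (g i (omegaSeq γ η₀ j b g i))‖ ^ 2 := by
  set B : ℕ → Vec m n := fun i => blockPart (b i) (g i (omegaSeq γ η₀ j b g i)) with hB
  have hcoord : ∀ c, (lamSeq γ η₀ j b g (k + 1) - omegaSeq γ η₀ j b g k) c ^ 2 ≤
      delaySum m τ * ∑ i ∈ Finset.range k, delayWeight m τ (k - i) * (γ ^ 2 * B i c ^ 2) := by
    intro c
    have h1 := abs_sub_compensated_le hm (fun i => etaSeq γ η₀ j b g i c)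
      (fun i => lamSeq γ η₀ j b g i c) (fun i => zetaSeq γ η₀ j b g i c) rfl rfl
      (fun i => by simp [lamSeq_succ]) (fun i => by simp [etaSeq_succ]) (hj c.1) (hτ c.1)
    have h2 : ∀ i, (m : ℝ) * theta m (i + 1) *
        (zetaSeq γ η₀ j b g (i + 1) c - zetaSeq γ η₀ j b g i c) = -(γ * B i c) := by
      intro i
      have := congrArg (fun v : Vec m n => v c) (mul_zetaSeq_sub hm γ η₀ j b g i)
      simpa using this
    have h3 : (lamSeq γ η₀ j b g (k + 1) - omegaSeq γ η₀ j b g k) c =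
        lamSeq γ η₀ j b g (k + 1) c - (etaSeq γ η₀ j b g (j k c.1) c +
          ∑ i ∈ Finset.Icc (j k c.1) k, rho m (j k c.1) i *
            (lamSeq γ η₀ j b g (j k c.1) c - etaSeq γ η₀ j b g (j k c.1 - 1) c)) := by
      rw [omegaSeq_eq γ η₀ j b g k hj]
      rfl
    simp only [h2, ← h3] at h1
    -- Weighted Cauchy–Schwarz: one factor `delaySum`, the other the weighted sum of squares, which
    -- can be added over coordinates.
    have h4 := Finset.sum_sq_le_sum_mul_sum_of_sq_le_mul (Finset.range k)
      (r := fun i => delayWeight m τ (k - i) * |-(γ * B i c)|)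
      (f := fun i => delayWeight m τ (k - i))
      (g := fun i => delayWeight m τ (k - i) * (γ ^ 2 * B i c ^ 2))
      (fun i _ => delayWeight_nonneg m τ _)
      (fun i _ => mul_nonneg (delayWeight_nonneg m τ _) (by positivity))
      (fun i _ => by rw [mul_pow, sq_abs]; exact le_of_eq (by ring))
    rw [← sq_abs]
    refine (pow_le_pow_left₀ (abs_nonneg _) h1 2).trans (h4.trans ?_)
    exact mul_le_mul_of_nonneg_right (sum_delayWeight_sub_le hm τ k)
      (Finset.sum_nonneg fun i _ => mul_nonneg (delayWeight_nonneg m τ _) (by positivity))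
  rw [EuclideanSpace.real_norm_sq_eq]
  refine (Finset.sum_le_sum fun c _ => hcoord c).trans (le_of_eq ?_)
  rw [← Finset.mul_sum, Finset.sum_comm, mul_comm (γ ^ 2), mul_assoc]
  congr 1
  rw [Finset.mul_sum]
  refine Finset.sum_congr rfl fun i _ => ?_
  rw [← Finset.mul_sum, ← Finset.mul_sum, EuclideanSpace.real_norm_sq_eq]
  ring

/-! ### Deterministic inequalities for the potential. -/

section Step

variable {H : Type*} [NormedAddCommGroup H] [InnerProductSpace ℝ H] {L : ℝ} {f : H → ℝ}
  {g : H → H}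

/-- The decrease of the potential before averaging over the draw of the block. -/
theorem IsSmoothConvex.potential_le (h : IsSmoothConvex L f g) {γ t μ : ℝ} (hγ : 0 < γ)
    (hμ : 0 < μ) (lam ζ x B : H) :
    t ^ 2 * (f (lam - γ • B) - f x) + μ ^ 2 / (2 * γ) * ‖ζ - (γ * t / μ) • B - x‖ ^ 2 ≤
      t ^ 2 * (f lam - f x) + inner ℝ (-(t ^ 2 * γ) • g lam - (t * μ) • (ζ - x)) B +
        t ^ 2 * (γ / 2) * (1 + L * γ) * ‖B‖ ^ 2 + μ ^ 2 / (2 * γ) * ‖ζ - x‖ ^ 2 := by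
  -- Here `μ` plays the role of the number of blocks `m`, and `t` that of `1/θ_{k+1}`.
  have h1 := h.upper lam (lam - γ • B)
  rw [sub_sub_cancel_left, inner_neg_right, real_inner_smul_right, norm_neg, norm_smul,
    mul_pow, Real.norm_of_nonneg hγ.le] at h1
  have h2 : ‖ζ - (γ * t / μ) • B - x‖ ^ 2 =
      ‖ζ - x‖ ^ 2 - 2 * (γ * t / μ) * inner ℝ (ζ - x) B + (γ * t / μ) ^ 2 * ‖B‖ ^ 2 := by
    rw [sub_right_comm, norm_sub_sq_real, real_inner_smul_right, norm_smul, mul_pow,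
      Real.norm_eq_abs, sq_abs]
    ring
  have h3 : μ ^ 2 / (2 * γ) * ‖ζ - (γ * t / μ) • B - x‖ ^ 2 =
      μ ^ 2 / (2 * γ) * ‖ζ - x‖ ^ 2 - t * μ * inner ℝ (ζ - x) B + t ^ 2 * (γ / 2) * ‖B‖ ^ 2 := by
    rw [h2]
    field_simp
  have h4 := mul_le_mul_of_nonneg_left h1 (sq_nonneg t)
  have h5 : inner ℝ (-(t ^ 2 * γ) • g lam - (t * μ) • (ζ - x)) B =
      -(t ^ 2 * γ) * inner ℝ (g lam) B - t * μ * inner ℝ (ζ - x) B := by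
    rw [inner_sub_left, real_inner_smul_left, real_inner_smul_left]
  rw [h3, h5]
  linarith

/-- The decrease of the potential after averaging over the draw of the block: the error caused
by the gradient at `om` instead of `lam`. -/
theorem IsSmoothConvex.averaged_potential_le (h : IsSmoothConvex L f g) {γ t θ μ : ℝ}
    (hγ : 0 < γ) (hμ : 0 < μ) (hθ : 0 < θ) (hθ1 : θ ≤ 1) (ht : t * θ = 1) (η ζ x om : H) :
    t ^ 2 * (f (θ • ζ + (1 - θ) • η) - f x) +
        μ⁻¹ * inner ℝ (-(t ^ 2 * γ) • g (θ • ζ + (1 - θ) • η) - (t * μ) • (ζ - x)) (g om) ≤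
      (t ^ 2 - t) * (f η - f x) + t ^ 2 * (L / 2 * (1 + 2 * (L * γ) / μ) *
        ‖θ • ζ + (1 - θ) • η - om‖ ^ 2 - γ / (2 * μ) * (3 / 2) * ‖g om‖ ^ 2) := by
  set lam := θ • ζ + (1 - θ) • η with hlam
  have ht0 : 0 < t := by
    by_contra! hle
    nlinarith
  have h1 := h.upper om lam
  have h2 := mul_le_mul_of_nonneg_left (h.lower om η) (by linarith : 0 ≤ 1 - θ)
  have h3 := mul_le_mul_of_nonneg_left (h.lower om x) hθ.le
  -- Coupling: smoothness from `om` to `lam` and convexity from `om` to `η` and `x`, weighted by `1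
  -- - θ` and `θ`, leave only the term in `ζ - x`, which later cancels against the expansion of the
  -- distance since `t θ = 1`.
  have h4 : inner ℝ (g om) (lam - om) = θ * inner ℝ (g om) (ζ - x) +
      (1 - θ) * inner ℝ (g om) (η - om) + θ * inner ℝ (g om) (x - om) := by
    rw [hlam]
    simp only [inner_sub_right, inner_add_right, real_inner_smul_right]
    ring
  have h5 : f lam - f x - θ * inner ℝ (g om) (ζ - x) ≤
      (1 - θ) * (f η - f x) + L / 2 * ‖lam - om‖ ^ 2 := by
    linarith
  -- Young's inequality gives up a quarter of `‖g om‖²` to replace the gradient at `lam` by the one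
  -- at `om`.
  have h6 : 3 / 4 * ‖g om‖ ^ 2 - L ^ 2 * ‖lam - om‖ ^ 2 ≤ inner ℝ (g lam) (g om) := by
    have h7 : inner ℝ (g lam) (g om) = ‖g om‖ ^ 2 + inner ℝ (g lam - g om) (g om) := by
      rw [inner_sub_left, real_inner_self_eq_norm_sq]
      ring
    have h8 := abs_le.1 (abs_real_inner_le_norm (g lam - g om) (g om))
    have h9 : ‖g lam - g om‖ ^ 2 ≤ (L * ‖lam - om‖) ^ 2 :=
      pow_le_pow_left₀ (norm_nonneg _) (h.lipschitz lam om) 2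
    nlinarith [sq_nonneg (‖g lam - g om‖ - 1 / 2 * ‖g om‖)]
  have h10 := mul_le_mul_of_nonneg_left h5 (sq_nonneg t)
  have h11 := mul_le_mul_of_nonneg_left h6 (by positivity : 0 ≤ t ^ 2 * γ / μ)
  have h12 : μ⁻¹ * inner ℝ (-(t ^ 2 * γ) • g lam - (t * μ) • (ζ - x)) (g om) =
      -(t ^ 2 * γ / μ * inner ℝ (g lam) (g om)) -
        t ^ 2 * (θ * inner ℝ (g om) (ζ - x)) := by
    rw [inner_sub_left, real_inner_smul_left, real_inner_smul_left, real_inner_comm (g om) (ζ - x)]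
    have : t ^ 2 * (θ * inner ℝ (g om) (ζ - x)) = t * (t * θ) * inner ℝ (g om) (ζ - x) := by ring
    rw [this, ht]
    field_simp
  have h13 : t ^ 2 * ((1 - θ) * (f η - f x)) = (t ^ 2 - t) * (f η - f x) := by
    have : t ^ 2 * (1 - θ) = t ^ 2 - t * (t * θ) := by ring
    rw [← mul_assoc, this, ht, mul_one]
  have h14 : t ^ 2 * (L / 2 * (1 + 2 * (L * γ) / μ) *
        ‖lam - om‖ ^ 2 - γ / (2 * μ) * (3 / 2) * ‖g om‖ ^ 2) =
      t ^ 2 * (L / 2 * ‖lam - om‖ ^ 2) -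
        t ^ 2 * γ / μ * (3 / 4 * ‖g om‖ ^ 2 - L ^ 2 * ‖lam - om‖ ^ 2) := by
    field_simp
    ring
  rw [h12, h14]
  linarith

theorem IsSmoothConvex.continuous (h : IsSmoothConvex L f g) [CompleteSpace H] :
    Continuous f :=
  continuous_iff_continuousAt.2 fun x => (h.hasGradientAt x).hasFDerivAt.continuousAt

theorem IsSmoothConvex.continuous_grad (h : IsSmoothConvex L f g) : Continuous g := by
  have : LipschitzWith L.toNNReal g := LipschitzWith.of_dist_le_mul fun x y => by
    rw [dist_eq_norm, dist_eq_norm]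
    exact (h.lipschitz x y).trans
      (mul_le_mul_of_nonneg_right (Real.le_coe_toNNReal L) (norm_nonneg _))
  exact this.continuous

end Step

/-! ### Measurability of the iterates -/

/-- The stale index is random but takes countably many values, so it may be frozen on each level
set. -/
theorem measurable_compensated {Ω : Type*} {mΩ : MeasurableSpace Ω} {m n : ℕ}
    {eta lam : ℕ → Ω → Vec m n} {j : Fin m → Ω → ℕ} (heta : ∀ i, Measurable (eta i))
    (hlam : ∀ i, Measurable (lam i)) (hj : ∀ p, Measurable (j p)) (k : ℕ) :
    Measurable fun s => compensated (fun i => eta i s) (fun i => lam i s) (fun p => j p s) k := by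
  refine (WithLp.measurable_toLp 2 _).comp (measurable_pi_lambda _ fun c => ?_)
  have hc : ∀ v : Ω → Vec m n, Measurable v → Measurable fun s => v s c := fun v hv =>
    (measurable_pi_apply c).comp ((WithLp.measurable_ofLp 2 _).comp hv)
  have h1 : Measurable fun q : ℕ × Ω => eta q.1 q.2 c +
      ∑ i ∈ Finset.Icc q.1 k, rho m q.1 i * (lam q.1 q.2 c - eta (q.1 - 1) q.2 c) := by
    refine measurable_from_prod_countable_right fun a => ?_
    have h2 := Finset.measurable_sum (Finset.Icc a k) fun i _ =>
      ((hc _ (hlam a)).sub (hc _ (heta (a - 1)))).const_mul (rho m a i)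
    exact (hc _ (heta a)).add h2
  exact h1.comp ((hj c.1).prodMk measurable_id)

section Iterates

variable {m n τ : ℕ} {Ξ : Type*} [MeasurableSpace Ξ] {φ : Vec m n → ℝ} {ϕ : Vec m n → Ξ → ℝ}
  {ν : Measure Ξ} {Ω : Type*} {mΩ : MeasurableSpace Ω} {P : Measure Ω} {ℱ : Filtration ℕ mΩ}
  {Mb : ℕ → ℕ} {j : ℕ → Fin m → Ω → ℕ} {b : ℕ → Ω → Fin m} {ξ : (k : ℕ) → Ω → Fin (Mb k) → Ξ}

theorem IsSampling.measurable_block (h : IsSampling P ℱ ν τ Mb j b ξ) (k : ℕ) :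
    Measurable[ℱ (k + 1)] (b k) := measurable_fst.comp (h.draw_measurable k)

theorem IsSampling.measurable_batch (h : IsSampling P ℱ ν τ Mb j b ξ) (k : ℕ) :
    Measurable[ℱ (k + 1)] (ξ k) := measurable_snd.comp (h.draw_measurable k)

/-- The induction carries the whole history because a stale point reads arbitrary earlier entries.
-/
theorem IsSampling.measurable_history (h : IsSampling P ℱ ν τ Mb j b ξ)
    (ho : IsStochasticOracle φ ϕ ν) (γ : ℝ) (η₀ : Vec m n) (k : ℕ) :
    (∀ i, Measurable[ℱ k] fun s => (history γ η₀ (fun i p => j i p s) (fun i => b i s)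
      (fun i => batchGradient ϕ (ξ i s)) k).eta i) ∧
    (∀ i, Measurable[ℱ k] fun s => (history γ η₀ (fun i p => j i p s) (fun i => b i s)
      (fun i => batchGradient ϕ (ξ i s)) k).lam i) ∧
    (∀ i, Measurable[ℱ k] fun s => (history γ η₀ (fun i p => j i p s) (fun i => b i s)
      (fun i => batchGradient ϕ (ξ i s)) k).zeta i) := by
  induction k with
  | zero => exact ⟨fun _ => measurable_const, fun _ => measurable_const, fun _ => measurable_const⟩
  | succ k ih =>
    obtain ⟨h1, h2, h3⟩ := ih
    have hle : ℱ k ≤ ℱ (k + 1) := ℱ.mono (Nat.le_succ k)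
    have hom := (measurable_compensated (mΩ := ℱ k) h1 h2 (h.delay_measurable k) k).mono hle le_rfl
    have h1' := fun i => (h1 i).mono hle le_rfl
    have h2' := fun i => (h2 i).mono hle le_rfl
    have h3' := fun i => (h3 i).mono hle le_rfl
    have hG := (ho.measurable_batchGradient (Mb k)).comp ((h.measurable_batch k).prodMk hom)
    have hB := measurable_blockPart.comp ((h.measurable_block k).prodMk hG)
    have hlam := ((h3' k).const_smul (theta m (k + 1))).add
      ((h1' k).const_smul (1 - theta m (k + 1)))
    have hzeta := (h3' k).add (hB.const_smul (γ / (m * theta m (k + 1)))).neg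
    have heta := hlam.add ((hzeta.sub (h3' k)).const_smul ((m : ℝ) * theta m (k + 1)))
    refine ⟨fun i => ?_, fun i => ?_, fun i => ?_⟩ <;>
      simp only [history, iterate, blockStep_eq] <;> by_cases hi : i = k + 1
    · subst hi
      simp only [Function.update_self]
      exact heta
    · simp only [Function.update_of_ne hi]
      exact h1' i
    · subst hi
      simp only [Function.update_self]
      exact hlam
    · simp only [Function.update_of_ne hi]
      exact h2' i
    · subst hi
      simp only [Function.update_self]
      exact hzeta
    · simp only [Function.update_of_ne hi]
      exact h3' i

theorem IsSampling.measurable_omegaSeq (h : IsSampling P ℱ ν τ Mb j b ξ)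
    (ho : IsStochasticOracle φ ϕ ν) (γ : ℝ) (η₀ : Vec m n) (k : ℕ) :
    Measurable[ℱ k] fun s => omegaSeq γ η₀ (fun i p => j i p s) (fun i => b i s)
      (fun i => batchGradient ϕ (ξ i s)) k :=
  measurable_compensated (mΩ := ℱ k) (h.measurable_history ho γ η₀ k).1
    (h.measurable_history ho γ η₀ k).2.1 (h.delay_measurable k) k

end Iterates

/-! ### Square integrable vectors -/

section MemLp

variable {Ω : Type*} {mΩ : MeasurableSpace Ω} {P : Measure Ω} {H : Type*} [NormedAddCommGroup H]

theorem integrable_norm_sq {f : Ω → H} (hf : MemLp f 2 P) :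
    Integrable (fun s => ‖f s‖ ^ 2) P :=
  (memLp_two_iff_integrable_sq_norm hf.1).1 hf

theorem integrable_inner_of_memLp [InnerProductSpace ℝ H] {f g : Ω → H} (hf : MemLp f 2 P)
    (hg : MemLp g 2 P) : Integrable (fun s => (inner ℝ (f s) (g s) : ℝ)) P := by
  refine ((integrable_norm_sq hf).add (integrable_norm_sq hg)).mono' (hf.1.inner hg.1)
    (Filter.Eventually.of_forall fun s => ?_)
  have := abs_real_inner_le_norm (f s) (g s)
  simp only [Real.norm_eq_abs, Pi.add_apply]
  nlinarith [sq_nonneg (‖f s‖ - ‖g s‖), sq_nonneg ‖f s‖, sq_nonneg ‖g s‖]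

theorem memLp_two_of_norm_sq_le {f : Ω → H} (hf : AEStronglyMeasurable f P) {g : Ω → ℝ}
    (hg : Integrable g P) (h : ∀ s, ‖f s‖ ^ 2 ≤ g s) : MemLp f 2 P := by
  rw [memLp_two_iff_integrable_sq_norm hf]
  refine hg.mono' (hf.norm.pow 2) (Filter.Eventually.of_forall fun s => ?_)
  rw [Real.norm_of_nonneg (by positivity)]
  exact h s

/-- A finite bound on the lower integral supplies square integrability as well, so none need be
assumed of the gradient noise. -/
theorem memLp_and_integral_sq_le {f : Ω → H} (hf : AEStronglyMeasurable f P) {C : ℝ}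
    (hC : 0 ≤ C) (h : ∫⁻ s, ‖f s‖ₑ ^ 2 ∂P ≤ ENNReal.ofReal C) :
    MemLp f 2 P ∧ ∫ s, ‖f s‖ ^ 2 ∂P ≤ C := by
  have h1 : ∀ s, ENNReal.ofReal (‖f s‖ ^ 2) = ‖f s‖ₑ ^ 2 := fun s => by
    rw [ENNReal.ofReal_pow (norm_nonneg _), ofReal_norm]
  constructor
  · rw [memLp_two_iff_integrable_sq_norm hf]
    refine ⟨hf.norm.pow 2, ?_⟩
    rw [hasFiniteIntegral_iff_ofReal (Filter.Eventually.of_forall fun s => by positivity)]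
    simp_rw [h1]
    exact h.trans_lt ENNReal.ofReal_lt_top
  · have h2 : AEStronglyMeasurable (fun s => ‖f s‖ ^ 2) P := hf.norm.pow 2
    rw [integral_eq_lintegral_of_nonneg_ae
      (Filter.Eventually.of_forall fun s => sq_nonneg ‖f s‖) h2]
    simp_rw [h1]
    exact ENNReal.toReal_le_of_le_ofReal hC h

theorem integrable_sub_minimum [InnerProductSpace ℝ H] [CompleteSpace H] [IsProbabilityMeasure P]
    {L : ℝ} {f : H → ℝ} {g : H → H} (h : IsSmoothConvex L f g) {x : H} (hg : g x = 0)
    (hx : ∀ y, f x ≤ f y) {y : Ω → H} (hy : MemLp y 2 P) :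
    Integrable (fun s => f (y s) - f x) P := by
  have hs := (integrable_norm_sq (hy.sub (memLp_const x))).const_mul (L / 2)
  refine hs.mono' ((h.continuous.comp_aestronglyMeasurable hy.1).sub aestronglyMeasurable_const)
    (Filter.Eventually.of_forall fun s => ?_)
  have := h.upper x (y s)
  rw [hg, inner_zero_left, add_zero] at this
  rw [Real.norm_of_nonneg (by linarith [hx (y s)])]
  simp only [Pi.sub_apply]
  linarith

theorem memLp_grad [InnerProductSpace ℝ H] [IsProbabilityMeasure P]
    {L : ℝ} {f : H → ℝ} {g : H → H} (h : IsSmoothConvex L f g) {x : H} (hg : g x = 0)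
    {y : Ω → H} (hy : MemLp y 2 P) : MemLp (fun s => g (y s)) 2 P := by
  refine (hy.sub (memLp_const x)).of_le_mul (c := L)
    (h.continuous_grad.comp_aestronglyMeasurable hy.1) (Filter.Eventually.of_forall fun s => ?_)
  have := h.lipschitz (y s) x
  rwa [hg, sub_zero] at this

end MemLp

/-! ### Expectation over the draws of one iteration -/

section Iterates

variable {m n τ : ℕ} {Ξ : Type*} [MeasurableSpace Ξ] {φ : Vec m n → ℝ} {ϕ : Vec m n → Ξ → ℝ}
  {ν : Measure Ξ} [IsProbabilityMeasure ν] {Ω : Type*} {mΩ : MeasurableSpace Ω} {P : Measure Ω}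
  [IsProbabilityMeasure P] {ℱ : Filtration ℕ mΩ} {Mb : ℕ → ℕ} {j : ℕ → Fin m → Ω → ℕ}
  {b : ℕ → Ω → Fin m} {ξ : (k : ℕ) → Ω → Fin (Mb k) → Ξ}

omit [IsProbabilityMeasure P] in
theorem IsSampling.batch_law (hm : 1 ≤ m) (h : IsSampling P ℱ ν τ Mb j b ξ) (k : ℕ) :
    P.map (ξ k) = Measure.pi fun _ => ν := by
  have : Nonempty (Fin m) := ⟨⟨0, hm⟩⟩
  have : IsProbabilityMeasure (uniformOn (Set.univ : Set (Fin m))) :=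
    isProbabilityMeasure_uniformOn Set.finite_univ Set.univ_nonempty
  have hD : Measurable fun s => (b k s, ξ k s) := (h.draw_measurable k).mono (ℱ.le _) le_rfl
  have h1 := congrArg (Measure.map Prod.snd) (h.draw_law k)
  rw [Measure.map_map measurable_snd hD] at h1
  exact h1.trans Measure.snd_prod

omit [IsProbabilityMeasure P] in
theorem IsSampling.block_law (hm : 1 ≤ m) (h : IsSampling P ℱ ν τ Mb j b ξ) (k : ℕ) :
    P.map (b k) = uniformOn (Set.univ : Set (Fin m)) := by
  have : Nonempty (Fin m) := ⟨⟨0, hm⟩⟩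
  have : IsProbabilityMeasure (uniformOn (Set.univ : Set (Fin m))) :=
    isProbabilityMeasure_uniformOn Set.finite_univ Set.univ_nonempty
  have hD : Measurable fun s => (b k s, ξ k s) := (h.draw_measurable k).mono (ℱ.le _) le_rfl
  have h1 := congrArg (Measure.map Prod.fst) (h.draw_law k)
  rw [Measure.map_map measurable_fst hD] at h1
  exact h1.trans Measure.fst_prod

omit [IsProbabilityMeasure ν] [IsProbabilityMeasure P] in
theorem IsSampling.indepFun_draw (h : IsSampling P ℱ ν τ Mb j b ξ) (k : ℕ) {𝒴 : Type*}
    [MeasurableSpace 𝒴] {Y : Ω → 𝒴} (hY : Measurable[ℱ k] Y) :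
    IndepFun (fun s => (b k s, ξ k s)) Y P := by
  rw [IndepFun_iff_Indep]
  exact indep_of_indep_of_le_right (h.draw_indep k) hY.comap_le

theorem IsSampling.indepFun_block (hm : 1 ≤ m) (h : IsSampling P ℱ ν τ Mb j b ξ) (k : ℕ)
    {𝒴 : Type*} [MeasurableSpace 𝒴] {Y : Ω → 𝒴} (hY : Measurable[ℱ k] Y) :
    IndepFun (b k) (fun s => (ξ k s, Y s)) P := by
  have hb : Measurable (b k) := (h.measurable_block k).mono (ℱ.le _) le_rfl
  have hξ : Measurable (ξ k) := (h.measurable_batch k).mono (ℱ.le _) le_rfl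
  refine indepFun_prodMk_of_indepFun hb hξ (hY.mono (ℱ.le _) le_rfl) ?_ (h.indepFun_draw k hY)
  rw [indepFun_iff_map_prod_eq_prod_map_map hb.aemeasurable hξ.aemeasurable, h.draw_law,
    h.block_law hm, h.batch_law hm]

/-- Averaging over the draw of the block and of the batch in iteration `k`. -/
theorem IsSampling.integral_step (hm : 1 ≤ m) (h : IsSampling P ℱ ν τ Mb j b ξ)
    (ho : IsStochasticOracle φ ϕ ν) (k : ℕ) {U om G : Ω → Vec m n} (hU : Measurable[ℱ k] U)
    (hom : Measurable[ℱ k] om) (hG : ∀ s, G s = batchGradient ϕ (ξ k s) (om s))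
    (hU2 : MemLp U 2 P) (hG2 : MemLp G 2 P) (κ : ℝ) :
    ∫ s, (inner ℝ (U s) (blockPart (b k s) (G s)) + κ * ‖blockPart (b k s) (G s)‖ ^ 2) ∂P =
      (m : ℝ)⁻¹ * (∫ s, inner ℝ (U s) (gradient φ (om s)) ∂P + κ * ∫ s, ‖G s‖ ^ 2 ∂P) := by
  have hb : Measurable (b k) := (h.measurable_block k).mono (ℱ.le _) le_rfl
  have hξ : Measurable (ξ k) := (h.measurable_batch k).mono (ℱ.le _) le_rfl
  have hU' : Measurable U := hU.mono (ℱ.le _) le_rfl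
  have hom' : Measurable om := hom.mono (ℱ.le _) le_rfl
  have hY : Measurable[ℱ k] fun s => (om s, U s) := hom.prodMk hU
  have hGeq : G = fun s => batchGradient ϕ (ξ k s) (om s) := funext hG
  have hZ : Measurable fun q : (Fin (Mb k) → Ξ) × Vec m n × Vec m n => (q.1, q.2.1) :=
    measurable_fst.prodMk (measurable_fst.comp measurable_snd)
  have hbg := (ho.measurable_batchGradient (Mb k)).comp hZ
  have hUm : Measurable fun q : (Fin (Mb k) → Ξ) × Vec m n × Vec m n => q.2.2 :=
    measurable_snd.comp measurable_snd
  have hpart : ∀ i, MemLp (fun s => blockPart i (G s)) 2 P := fun i =>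
    hG2.of_le ((measurable_blockPart.comp (measurable_const (a := i) |>.prodMk
      measurable_id)).comp_aemeasurable hG2.1.aemeasurable).aestronglyMeasurable
      (Filter.Eventually.of_forall fun s => norm_blockPart_le i (G s))
  have hi1 : ∀ i, Integrable (fun s => (inner ℝ (U s) (blockPart i (G s)) : ℝ)) P := fun i =>
    integrable_inner_of_memLp hU2 (hpart i)
  have hi2 : ∀ i, Integrable (fun s => κ * ‖blockPart i (G s)‖ ^ 2) P := fun i =>
    (integrable_norm_sq (hpart i)).const_mul κ
  -- Average over the block first, with batch and past frozen: the blocks reassemble `G` and, by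
  -- Pythagoras, `‖G‖²`. The batch is averaged afterwards.
  have hdraw := integral_uniform_draw (P := P) hb (h.block_law hm k)
    (h.indepFun_block hm k hY)
    (Φ := fun i q => inner ℝ q.2.2 (blockPart i (batchGradient ϕ q.1 q.2.1)) +
      κ * ‖blockPart i (batchGradient ϕ q.1 q.2.1)‖ ^ 2)
    (fun i => by
      have h1 := measurable_blockPart.comp ((measurable_const (a := i)).prodMk hbg)
      exact (Measurable.inner (𝕜 := ℝ) hUm h1).add ((h1.norm.pow_const 2).const_mul κ))
    (fun i => by
      have h2 := (hi1 i).add (hi2 i)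
      rw [hGeq] at h2
      exact h2)
  simp only [← hG] at hdraw
  rw [hdraw]
  congr 1
  have hi3 : ∀ i, Integrable (fun s => (inner ℝ (U s) (blockPart i (G s)) : ℝ) +
    κ * ‖blockPart i (G s)‖ ^ 2) P := fun i => (hi1 i).add (hi2 i)
  rw [← integral_finsetSum _ fun i _ => hi3 i]
  have h3 : ∀ s, ∑ i, (inner ℝ (U s) (blockPart i (G s)) + κ * ‖blockPart i (G s)‖ ^ 2) =
      inner ℝ (U s) (G s) + κ * ‖G s‖ ^ 2 := by
    intro s
    rw [Finset.sum_add_distrib, ← inner_sum, sum_blockPart, ← Finset.mul_sum,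
      sum_norm_blockPart_sq]
  simp_rw [h3]
  have hUG : Integrable (fun s => (inner ℝ (U s) (G s) : ℝ)) P := integrable_inner_of_memLp hU2 hG2
  rw [integral_add hUG ((integrable_norm_sq hG2).const_mul κ), integral_const_mul]
  congr 1
  have hind : IndepFun (ξ k) (fun s => (om s, U s)) P :=
    (h.indepFun_draw k hY).comp (φ := Prod.snd) (ψ := id) measurable_snd measurable_id
  rw [hGeq] at hUG ⊢
  exact ho.integral_inner_batchGradient (h.batch_pos k) hξ (h.batch_law hm k) hU' hom' hind hUG

/-- The second moment of the averaged gradient is that of the exact gradient plus the variance. -/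
theorem IsSampling.integral_norm_sq (hm : 1 ≤ m) (h : IsSampling P ℱ ν τ Mb j b ξ)
    (ho : IsStochasticOracle φ ϕ ν) (k : ℕ) {om G : Ω → Vec m n} (hom : Measurable[ℱ k] om)
    (hgm : Measurable (gradient φ)) (hG : ∀ s, G s = batchGradient ϕ (ξ k s) (om s))
    (hg2 : MemLp (fun s => gradient φ (om s)) 2 P) (hG2 : MemLp G 2 P) :
    ∫ s, ‖G s‖ ^ 2 ∂P =
      ∫ s, ‖gradient φ (om s)‖ ^ 2 ∂P + ∫ s, ‖gradient φ (om s) - G s‖ ^ 2 ∂P := by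
  have hξ : Measurable (ξ k) := (h.measurable_batch k).mono (ℱ.le _) le_rfl
  have hU : Measurable[ℱ k] fun s => gradient φ (om s) := hgm.comp hom
  have hGeq : G = fun s => batchGradient ϕ (ξ k s) (om s) := funext hG
  have hind : IndepFun (ξ k) (fun s => (om s, gradient φ (om s))) P :=
    (h.indepFun_draw k (hom.prodMk hU)).comp (φ := Prod.snd) (ψ := id) measurable_snd
      measurable_id
  have hUG : Integrable (fun s => (inner ℝ (gradient φ (om s)) (G s) : ℝ)) P :=
    integrable_inner_of_memLp hg2 hG2
  -- Unbiasedness evaluates the cross term.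
  have h1 : ∫ s, inner ℝ (gradient φ (om s)) (G s) ∂P = ∫ s, ‖gradient φ (om s)‖ ^ 2 ∂P := by
    simp_rw [← real_inner_self_eq_norm_sq]
    rw [hGeq] at hUG ⊢
    exact ho.integral_inner_batchGradient (h.batch_pos k) hξ (h.batch_law hm k)
      (hU.mono (ℱ.le _) le_rfl) (hom.mono (ℱ.le _) le_rfl) hind hUG
  have h2 : ∀ s, ‖gradient φ (om s) - G s‖ ^ 2 =
      ‖gradient φ (om s)‖ ^ 2 - 2 * inner ℝ (gradient φ (om s)) (G s) + ‖G s‖ ^ 2 :=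
    fun s => norm_sub_sq_real _ _
  have h3 : Integrable (fun s => ‖gradient φ (om s)‖ ^ 2 -
    2 * (inner ℝ (gradient φ (om s)) (G s) : ℝ)) P :=
    (integrable_norm_sq hg2).sub (hUG.const_mul 2)
  simp_rw [h2]
  rw [integral_add h3 (integrable_norm_sq hG2),
    integral_sub (integrable_norm_sq hg2) (hUG.const_mul 2), integral_const_mul, h1]
  ring

end Iterates

/-! ### Convergence in expectation -/

/-- The recurrences, the delay estimate and the measurability of the iterates, on which the
convergence analysis rests. -/
structure IsRun {m n : ℕ} {Ω : Type*} {mΩ : MeasurableSpace Ω} (ℱ : Filtration ℕ mΩ) (τ : ℕ)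
    (γ : ℝ) (η₀ : Vec m n) (b : ℕ → Ω → Fin m) (eta lam zeta om G : ℕ → Ω → Vec m n) : Prop where
  eta_zero : ∀ s, eta 0 s = η₀
  zeta_zero : ∀ s, zeta 0 s = η₀
  lam_succ : ∀ k s, lam (k + 1) s =
    theta m (k + 1) • zeta k s + (1 - theta m (k + 1)) • eta k s
  zeta_succ : ∀ k s, zeta (k + 1) s =
    zeta k s - (γ * recip m k / m) • blockPart (b k s) (G k s)
  eta_succ : ∀ k s, eta (k + 1) s = lam (k + 1) s - γ • blockPart (b k s) (G k s)
  delay : ∀ k s, ‖lam (k + 1) s - om k s‖ ^ 2 ≤ γ ^ 2 * delaySum m τ *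
    ∑ i ∈ Finset.range k, delayWeight m τ (k - i) * ‖blockPart (b i s) (G i s)‖ ^ 2
  measurable_eta : ∀ k, Measurable[ℱ k] (eta k)
  measurable_zeta : ∀ k, Measurable[ℱ k] (zeta k)
  measurable_om : ∀ k, Measurable[ℱ k] (om k)

section Iterates

variable {m n τ : ℕ} {Ξ : Type*} [MeasurableSpace Ξ] {φ : Vec m n → ℝ} {ϕ : Vec m n → Ξ → ℝ}
  {ν : Measure Ξ} {Ω : Type*} {mΩ : MeasurableSpace Ω} {P : Measure Ω}
  {ℱ : Filtration ℕ mΩ} {Mb : ℕ → ℕ} {j : ℕ → Fin m → Ω → ℕ}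
  {b : ℕ → Ω → Fin m} {ξ : (k : ℕ) → Ω → Fin (Mb k) → Ξ} {γ : ℝ} {η₀ : Vec m n}

theorem IsSampling.isRun (hm : 1 ≤ m) (h : IsSampling P ℱ ν τ Mb j b ξ)
    (ho : IsStochasticOracle φ ϕ ν) (γ : ℝ) (η₀ : Vec m n) :
    IsRun ℱ τ γ η₀ b
      (fun k s => etaSeq γ η₀ (fun i p => j i p s) (fun i => b i s)
        (fun i => batchGradient ϕ (ξ i s)) k)
      (fun k s => lamSeq γ η₀ (fun i p => j i p s) (fun i => b i s)
        (fun i => batchGradient ϕ (ξ i s)) k)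
      (fun k s => zetaSeq γ η₀ (fun i p => j i p s) (fun i => b i s)
        (fun i => batchGradient ϕ (ξ i s)) k)
      (fun k s => omegaSeq γ η₀ (fun i p => j i p s) (fun i => b i s)
        (fun i => batchGradient ϕ (ξ i s)) k)
      (fun k s => batchGradient ϕ (ξ k s) (omegaSeq γ η₀ (fun i p => j i p s) (fun i => b i s)
        (fun i => batchGradient ϕ (ξ i s)) k)) where
  eta_zero _ := rfl
  zeta_zero _ := rfl
  lam_succ k s := lamSeq_succ _ _ _ _ _ k
  zeta_succ k s := by
    rw [zetaSeq_succ_eq]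
    congr 2
    unfold recip
    have := (theta_pos hm k).ne'
    field_simp
  eta_succ k s := etaSeq_succ_eq hm _ _ _ _ _ k
  delay k s := norm_lamSeq_sub_omegaSeq_sq_le hm _ _ _ _ _ k (fun p => h.delay_le k p s)
    fun p => h.le_delay_add k p s
  measurable_eta k := (h.measurable_history ho γ η₀ k).1 k
  measurable_zeta k := (h.measurable_history ho γ η₀ k).2.2 k
  measurable_om k := h.measurable_omegaSeq ho γ η₀ k

variable {eta lam zeta om G : ℕ → Ω → Vec m n}

theorem IsRun.measurable_lam (hr : IsRun ℱ τ γ η₀ b eta lam zeta om G) (k : ℕ) :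
    Measurable[ℱ k] (lam (k + 1)) := by
  have h1 := ((hr.measurable_zeta k).const_smul (theta m (k + 1))).add
    ((hr.measurable_eta k).const_smul (1 - theta m (k + 1)))
  have h2 : lam (k + 1) = fun s => theta m (k + 1) • zeta k s + (1 - theta m (k + 1)) • eta k s :=
    funext (hr.lam_succ k)
  rw [h2]
  exact h1

theorem memLp_blockPart {b : Ω → Fin m} (hb : Measurable b) {G : Ω → Vec m n}
    (hG : MemLp G 2 P) : MemLp (fun s => blockPart (b s) (G s)) 2 P :=
  hG.of_le (measurable_blockPart.comp_aemeasurable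
    (hb.aemeasurable.prodMk hG.1.aemeasurable)).aestronglyMeasurable
    (Filter.Eventually.of_forall fun s => norm_blockPart_le (b s) (G s))

theorem IsRun.memLp_lam (hr : IsRun ℱ τ γ η₀ b eta lam zeta om G) {k : ℕ}
    (heta : MemLp (eta k) 2 P) (hzeta : MemLp (zeta k) 2 P) : MemLp (lam (k + 1)) 2 P := by
  have h1 := (hzeta.const_smul (theta m (k + 1))).add (heta.const_smul (1 - theta m (k + 1)))
  have h2 : lam (k + 1) = fun s => theta m (k + 1) • zeta k s + (1 - theta m (k + 1)) • eta k s :=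
    funext (hr.lam_succ k)
  rw [h2]
  exact h1

theorem IsRun.memLp_lam_sub_om (hr : IsRun ℱ τ γ η₀ b eta lam zeta om G)
    (hb : ∀ k, Measurable (b k)) {k : ℕ} (hG : ∀ i < k, MemLp (G i) 2 P) :
    MemLp (fun s => lam (k + 1) s - om k s) 2 P := by
  refine memLp_two_of_norm_sq_le
    (((hr.measurable_lam k).sub (hr.measurable_om k)).mono (ℱ.le k) le_rfl).aestronglyMeasurable
    ?_ (hr.delay k)
  refine (integrable_finsetSum _ fun i hi => ?_).const_mul _
  exact (integrable_norm_sq (memLp_blockPart (hb i) (hG i (Finset.mem_range.1 hi)))).const_mul _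

/-- Square integrability propagates: earlier gradients control `λ - ω`, hence `ω`; then `∇φ(ω)`
grows linearly, and the noise is square integrable by the variance bound, hence so is `G`. -/
theorem IsRun.memLp [IsProbabilityMeasure P] (hr : IsRun ℱ τ γ η₀ b eta lam zeta om G)
    (hb : ∀ k, Measurable (b k)) {L : ℝ} (hS : IsSmoothConvex L φ (gradient φ)) {x : Vec m n}
    (hx : gradient φ x = 0) {K : ℕ}
    (hvar : ∀ k ≤ K, MemLp (fun s => gradient φ (om k s) - G k s) 2 P) :
    ∀ k ≤ K + 1, MemLp (eta k) 2 P ∧ MemLp (zeta k) 2 P ∧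
      ∀ i < k, MemLp (om i) 2 P ∧ MemLp (G i) 2 P := by
  intro k hk
  induction k with
  | zero =>
    refine ⟨?_, ?_, fun i hi => absurd hi (Nat.not_lt_zero i)⟩
    · rw [show eta 0 = fun _ => η₀ from funext hr.eta_zero]
      exact memLp_const η₀
    · rw [show zeta 0 = fun _ => η₀ from funext hr.zeta_zero]
      exact memLp_const η₀
  | succ k ih =>
    obtain ⟨h1, h2, h3⟩ := ih (by omega)
    have hlam := hr.memLp_lam h1 h2
    have hom : MemLp (om k) 2 P := by
      have := hlam.sub (hr.memLp_lam_sub_om hb fun i hi => (h3 i hi).2)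
      refine this.ae_eq (Filter.Eventually.of_forall fun s => ?_)
      simp
    have hG : MemLp (G k) 2 P := by
      have := (memLp_grad hS hx hom).sub (hvar k (by omega))
      refine this.ae_eq (Filter.Eventually.of_forall fun s => ?_)
      simp
    have hB := memLp_blockPart (hb k) hG
    refine ⟨?_, ?_, fun i hi => ?_⟩
    · rw [show eta (k + 1) = fun s => lam (k + 1) s - γ • blockPart (b k s) (G k s) from
        funext (hr.eta_succ k)]
      exact hlam.sub (hB.const_smul γ)
    · rw [show zeta (k + 1) = fun s => zeta k s - (γ * recip m k / m) •
        blockPart (b k s) (G k s) from funext (hr.zeta_succ k)]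
      exact h2.sub (hB.const_smul (γ * recip m k / (m : ℝ)))
    · rcases Nat.lt_succ_iff_lt_or_eq.1 hi with hi | rfl
      · exact h3 i hi
      · exact ⟨hom, hG⟩

variable [IsProbabilityMeasure ν] [IsProbabilityMeasure P]

/-- Only one of the `m` blocks moves per iteration, so averaging each squared update over its draw
gains the factor `1/m`. This is `integral_step` with `U = 0` and `κ = 1`. -/
theorem IsRun.integral_delay_le (hm : 1 ≤ m) (h : IsSampling P ℱ ν τ Mb j b ξ)
    (ho : IsStochasticOracle φ ϕ ν) (hr : IsRun ℱ τ γ η₀ b eta lam zeta om G)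
    (hG : ∀ k s, G k s = batchGradient ϕ (ξ k s) (om k s)) {k : ℕ}
    (hG2 : ∀ i < k, MemLp (G i) 2 P) :
    ∫ s, ‖lam (k + 1) s - om k s‖ ^ 2 ∂P ≤ γ ^ 2 * delaySum m τ / m *
      ∑ i ∈ Finset.range k, delayWeight m τ (k - i) * ∫ s, ‖G i s‖ ^ 2 ∂P := by
  have hb : ∀ k, Measurable (b k) := fun k => (h.measurable_block k).mono (ℱ.le _) le_rfl
  have hint : ∀ i ∈ Finset.range k, Integrable
      (fun s => delayWeight m τ (k - i) * ‖blockPart (b i s) (G i s)‖ ^ 2) P := fun i hi =>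
    (integrable_norm_sq (memLp_blockPart (hb i) (hG2 i (Finset.mem_range.1 hi)))).const_mul _
  refine (integral_mono (integrable_norm_sq (hr.memLp_lam_sub_om hb hG2))
    ((integrable_finsetSum _ hint).const_mul _) (hr.delay k)).trans (le_of_eq ?_)
  rw [integral_const_mul, integral_finsetSum _ hint, div_mul_eq_mul_div, mul_div_assoc,
    Finset.sum_div]
  congr 1
  refine Finset.sum_congr rfl fun i hi => ?_
  have h1 := h.integral_step hm ho i (U := fun _ => 0) measurable_const (hr.measurable_om i)
    (hG i) (memLp_const 0) (hG2 i (Finset.mem_range.1 hi)) 1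
  simp only [inner_zero_left, zero_add, one_mul, integral_zero] at h1
  rw [integral_const_mul, h1]
  ring

/-- The expected decrease of the potential in iteration `k`. -/
theorem IsRun.expected_step (hm : 1 ≤ m) (h : IsSampling P ℱ ν τ Mb j b ξ)
    (ho : IsStochasticOracle φ ϕ ν) (hr : IsRun ℱ τ γ η₀ b eta lam zeta om G)
    (hG : ∀ k s, G k s = batchGradient ϕ (ξ k s) (om k s)) (hγ : 0 < γ) {L : ℝ}
    (hS : IsSmoothConvex L φ (gradient φ)) {x : Vec m n} (hx : gradient φ x = 0)
    (hmin : ∀ y, φ x ≤ φ y) {k : ℕ} (heta : MemLp (eta k) 2 P) (hzeta : MemLp (zeta k) 2 P)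
    (heta' : MemLp (eta (k + 1)) 2 P) (hzeta' : MemLp (zeta (k + 1)) 2 P)
    (hom : MemLp (om k) 2 P) (hG2 : MemLp (G k) 2 P) :
    recip m k ^ 2 * ∫ s, (φ (eta (k + 1) s) - φ x) ∂P +
        m ^ 2 / (2 * γ) * ∫ s, ‖zeta (k + 1) s - x‖ ^ 2 ∂P ≤
      (recip m k ^ 2 - recip m k) * ∫ s, (φ (eta k s) - φ x) ∂P +
        m ^ 2 / (2 * γ) * ∫ s, ‖zeta k s - x‖ ^ 2 ∂P + recip m k ^ 2 *
        (L / 2 * (1 + 2 * (L * γ) / m) * ∫ s, ‖lam (k + 1) s - om k s‖ ^ 2 ∂P +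
          γ / (2 * m) * (-(3 / 2) * ∫ s, ‖gradient φ (om k s)‖ ^ 2 ∂P +
            (1 + L * γ) * ∫ s, ‖G k s‖ ^ 2 ∂P)) := by
  have hm0 : (0 : ℝ) < m := by exact_mod_cast hm
  have hb : ∀ k, Measurable (b k) := fun k => (h.measurable_block k).mono (ℱ.le _) le_rfl
  set t := recip m k with ht
  set κ : ℝ := t ^ 2 * (γ / 2) * (1 + L * γ) with hκ
  -- The coefficient of the block update in the potential; it is known before iteration `k`, so the
  -- draw can be averaged out.
  set U : Ω → Vec m n := fun s => -(t ^ 2 * γ) • gradient φ (lam (k + 1) s) -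
    (t * m) • (zeta k s - x) with hU
  have hlam := hr.memLp_lam heta hzeta
  have hB := memLp_blockPart (hb k) hG2
  have hglam := memLp_grad hS hx hlam
  have hgom := memLp_grad hS hx hom
  have hzx : MemLp (fun s => zeta k s - x) 2 P := hzeta.sub (memLp_const x)
  have hzx' : MemLp (fun s => zeta (k + 1) s - x) 2 P := hzeta'.sub (memLp_const x)
  have hU2 : MemLp U 2 P := (hglam.const_smul (-(t ^ 2 * γ))).sub (hzx.const_smul (t * (m : ℝ)))
  have hUm : Measurable[ℱ k] U :=
    ((hS.continuous_grad.measurable.comp (hr.measurable_lam k)).const_smul (-(t ^ 2 * γ))).sub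
      (((hr.measurable_zeta k).sub measurable_const).const_smul (t * (m : ℝ)))
  have i1 : Integrable (fun s => t ^ 2 * (φ (eta (k + 1) s) - φ x)) P :=
    (integrable_sub_minimum hS hx hmin heta').const_mul _
  have i2 : Integrable (fun s => (m : ℝ) ^ 2 / (2 * γ) * ‖zeta (k + 1) s - x‖ ^ 2) P :=
    (integrable_norm_sq hzx').const_mul _
  have i3 : Integrable (fun s => t ^ 2 * (φ (lam (k + 1) s) - φ x)) P :=
    (integrable_sub_minimum hS hx hmin hlam).const_mul _
  have i4 : Integrable (fun s => (inner ℝ (U s) (blockPart (b k s) (G k s)) : ℝ) +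
      κ * ‖blockPart (b k s) (G k s)‖ ^ 2) P :=
    (integrable_inner_of_memLp hU2 hB).add ((integrable_norm_sq hB).const_mul κ)
  have i5 : Integrable (fun s => (m : ℝ) ^ 2 / (2 * γ) * ‖zeta k s - x‖ ^ 2) P :=
    (integrable_norm_sq hzx).const_mul _
  have i6 : Integrable (fun s => (m : ℝ)⁻¹ * (inner ℝ (U s) (gradient φ (om k s)) : ℝ)) P :=
    (integrable_inner_of_memLp hU2 hgom).const_mul _
  have i7 : Integrable (fun s => (t ^ 2 - t) * (φ (eta k s) - φ x)) P :=
    (integrable_sub_minimum hS hx hmin heta).const_mul _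
  have hlo : MemLp (fun s => lam (k + 1) s - om k s) 2 P := hlam.sub hom
  have i8 : Integrable (fun s => L / 2 * (1 + 2 * (L * γ) / m) *
      ‖lam (k + 1) s - om k s‖ ^ 2) P := (integrable_norm_sq hlo).const_mul _
  have i9 : Integrable (fun s => γ / (2 * m) * (3 / 2) * ‖gradient φ (om k s)‖ ^ 2) P :=
    (integrable_norm_sq hgom).const_mul _
  have i10 : Integrable (fun s => t ^ 2 * (L / 2 * (1 + 2 * (L * γ) / m) *
      ‖lam (k + 1) s - om k s‖ ^ 2 - γ / (2 * m) * (3 / 2) * ‖gradient φ (om k s)‖ ^ 2)) P :=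
    (i8.sub i9).const_mul _
  have hpath : ∀ s, t ^ 2 * (φ (eta (k + 1) s) - φ x) +
      (m : ℝ) ^ 2 / (2 * γ) * ‖zeta (k + 1) s - x‖ ^ 2 ≤
      t ^ 2 * (φ (lam (k + 1) s) - φ x) +
        (inner ℝ (U s) (blockPart (b k s) (G k s)) + κ * ‖blockPart (b k s) (G k s)‖ ^ 2) +
        (m : ℝ) ^ 2 / (2 * γ) * ‖zeta k s - x‖ ^ 2 := by
    intro s
    rw [hr.eta_succ, hr.zeta_succ, ← add_assoc]
    exact hS.potential_le hγ hm0 _ _ _ _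
  have hpath' : ∀ s, t ^ 2 * (φ (lam (k + 1) s) - φ x) +
      (m : ℝ)⁻¹ * inner ℝ (U s) (gradient φ (om k s)) ≤
      (t ^ 2 - t) * (φ (eta k s) - φ x) + t ^ 2 * (L / 2 * (1 + 2 * (L * γ) / m) *
      ‖lam (k + 1) s - om k s‖ ^ 2 - γ / (2 * m) * (3 / 2) * ‖gradient φ (om k s)‖ ^ 2) := by
    intro s
    simp only [hU, hr.lam_succ]
    exact hS.averaged_potential_le hγ hm0 (theta_pos hm k) (theta_le_one hm k)
      (recip_mul_theta hm k) _ _ _ _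
  have h34 : Integrable (fun s => t ^ 2 * (φ (lam (k + 1) s) - φ x) +
      ((inner ℝ (U s) (blockPart (b k s) (G k s)) : ℝ) +
        κ * ‖blockPart (b k s) (G k s)‖ ^ 2)) P := i3.add i4
  have e1 := integral_mono (i1.add i2) (h34.add i5) hpath
  have e2 := integral_mono (i3.add i6) (i7.add i10) hpath'
  simp only [Pi.add_apply] at e1 e2
  rw [integral_add i1 i2, integral_add h34 i5, integral_add i3 i4, integral_const_mul,
    integral_const_mul, integral_const_mul,
    h.integral_step hm ho k hUm (hr.measurable_om k) (hG k) hU2 hG2 κ, integral_const_mul] at e1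
  rw [integral_add i3 i6, integral_add i7 i10, integral_const_mul, integral_const_mul,
    integral_const_mul, integral_const_mul, integral_sub i8 i9, integral_const_mul,
    integral_const_mul] at e2
  have hκm : (m : ℝ)⁻¹ * (κ * ∫ s, ‖G k s‖ ^ 2 ∂P) =
      t ^ 2 * (γ / (2 * m) * ((1 + L * γ) * ∫ s, ‖G k s‖ ^ 2 ∂P)) := by
    rw [hκ]
    field_simp
  rw [mul_add, hκm] at e1
  linarith

/-- The expected suboptimality after `K + 1` iterations is at most `ε`. -/
theorem IsRun.integral_sub_le (hτ : 1 ≤ τ) (hm : τ ≤ m) (h : IsSampling P ℱ ν τ Mb j b ξ)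
    (ho : IsStochasticOracle φ ϕ ν) (hr : IsRun ℱ τ γ η₀ b eta lam zeta om G)
    (hG : ∀ k s, G k s = batchGradient ϕ (ξ k s) (om k s)) (hγ : 0 < γ) {L : ℝ} (hL : 0 < L)
    (hS : IsSmoothConvex L φ (gradient φ)) {x : Vec m n} (hmin : ∀ y, φ x ≤ φ y) {c ε : ℝ}
    (hc : 0 < c) (hε : 0 < ε)
    (hrate : 3 * L * γ + 12 * L * γ * (((τ : ℝ) ^ 2 + τ) / m + 2 * τ) ^ 2 ≤ 1)
    (hrate' : c ≤ 3 * L * γ + 12 * L * γ * (((τ : ℝ) ^ 2 + τ) / m + 2 * τ) ^ 2) {K : ℕ}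
    (hK : 40 / Real.sqrt c * (m * τ * Real.sqrt L / Real.sqrt ε * ‖η₀ - x‖) ≤ K)
    (hvar : ∀ k ≤ K, ∫⁻ s, ‖gradient φ (om k s) - G k s‖ₑ ^ 2 ∂P ≤
      ENNReal.ofReal (m * L * theta m (k + 1) * ε / 8)) :
    MemLp (eta (K + 1)) 2 P ∧ ∫ s, (φ (eta (K + 1) s) - φ x) ∂P ≤ ε := by
  have hm1 : 1 ≤ m := hτ.trans hm
  have hm0 : (0 : ℝ) < m := by exact_mod_cast hm1
  have hx : gradient φ x = 0 := hS.gradient_eq_zero hL hmin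
  have hgm : Measurable (gradient φ) := hS.continuous_grad.measurable
  have hb : ∀ k, Measurable (b k) := fun k => (h.measurable_block k).mono (ℱ.le _) le_rfl
  have hGm : ∀ k, Measurable (G k) := fun k => by
    rw [show G k = fun s => batchGradient ϕ (ξ k s) (om k s) from funext (hG k)]
    have h1 : Measurable fun s => (ξ k s, om k s) :=
      ((h.measurable_batch k).mono (ℱ.le _) le_rfl).prodMk
        ((hr.measurable_om k).mono (ℱ.le _) le_rfl)
    have h2 := (ho.measurable_batchGradient (Mb k)).comp h1
    exact h2
  have hv : ∀ k ≤ K, MemLp (fun s => gradient φ (om k s) - G k s) 2 P ∧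
      ∫ s, ‖gradient φ (om k s) - G k s‖ ^ 2 ∂P ≤ m * L * theta m (k + 1) * ε / 8 := by
    intro k hk
    have hθ := theta_pos hm1 k
    refine memLp_and_integral_sq_le ?_ (by positivity) (hvar k hk)
    exact ((hgm.comp ((hr.measurable_om k).mono (ℱ.le _) le_rfl)).sub
      (hGm k)).aestronglyMeasurable
  have hmem := hr.memLp hb hS hx fun k hk => (hv k hk).1
  have hlast := (hmem (K + 1) le_rfl).2.2
  refine ⟨(hmem (K + 1) le_rfl).1, ?_⟩
  have hsum := sum_step_le hτ hm hL hγ hε hrate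
    (e := fun k => ∫ s, (φ (eta k s) - φ x) ∂P)
    (v := fun k => (m : ℝ) ^ 2 / (2 * γ) * ∫ s, ‖zeta k s - x‖ ^ 2 ∂P)
    (p := fun k => ∫ s, ‖gradient φ (om k s)‖ ^ 2 ∂P)
    (q := fun k => ∫ s, ‖G k s‖ ^ 2 ∂P)
    (r := fun k => ∫ s, ‖lam (k + 1) s - om k s‖ ^ 2 ∂P)
    (σ := fun k => ∫ s, ‖gradient φ (om k s) - G k s‖ ^ 2 ∂P) (K := K)
    (fun k => mul_nonneg (by positivity) (integral_nonneg fun s => sq_nonneg _))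
    (fun k => integral_nonneg fun s => sq_nonneg _)
    (fun k hk => h.integral_norm_sq hm1 ho k (hr.measurable_om k) hgm (hG k)
      (memLp_grad hS hx (hlast k (by omega)).1) (hlast k (by omega)).2)
    (fun k hk => (hv k hk).2)
    (fun k hk => hr.integral_delay_le hm1 h ho hG fun i hi => (hlast i (by omega)).2)
    (fun k hk => hr.expected_step hm1 h ho hG hγ hS hx hmin (hmem k (by omega)).1
      (hmem k (by omega)).2.1 (hmem (k + 1) (by omega)).1 (hmem (k + 1) (by omega)).2.1
      (hlast k (by omega)).1 (hlast k (by omega)).2)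
  simp only [hr.eta_zero, hr.zeta_zero, integral_const, probReal_univ, one_smul] at hsum
  refine final_bound hτ hm hc hL hγ hε (norm_nonneg (η₀ - x)) hrate hrate' hK ?_ hsum
  -- The initial gap is at most `(L/2)‖η₀ - x‖²` by smoothness at the stationary point `x`.
  have := hS.upper x η₀
  rw [hx, inner_zero_left, add_zero] at this
  linarith

end Iterates

end ASBCDS

end

/-! ### From the dual gap to the primal bounds. -/

theorem mainTheorem3 (c : ℝ) (hc : 0 < c) :
    ∃ C : ℝ, 0 < C ∧
      ∀ (m n τ : ℕ) (_ : 1 ≤ τ) (_ : τ ≤ m)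
        -- the primal problem
        (W : ASBCDS.Mat m n) (_ : W.PosSemidef)
        (X : Set (ASBCDS.Vec m n)) (F : ASBCDS.Vec m n → ℝ)
        (μ : ℝ) (_ : 0 < μ) (_ : StrongConvexOn X μ F)
        -- the maximum in the definition of the dual objective is attained
        (_ : ∀ η : ASBCDS.Vec m n, ∃ x, ASBCDS.IsPrimalOf X F (ASBCDS.sqrtOp W η) x)
        -- primal and dual optimum
        (xs ηs : ASBCDS.Vec m n) (_ : ASBCDS.IsPrimalOptimum W X F xs)
        (_ : ASBCDS.IsDualOptimum W X F ηs)
        -- the smoothness constant of the dual objective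
        (L : ℝ) (_ : L = ASBCDS.lambdaMax W / μ)
        -- the stochastic oracle for the dual objective
        (Ξ : Type*) (_ : MeasurableSpace Ξ) (ν : MeasureTheory.Measure Ξ)
        (_ : MeasureTheory.IsProbabilityMeasure ν) (ϕ : ASBCDS.Vec m n → Ξ → ℝ)
        (_ : ASBCDS.IsStochasticOracle (ASBCDS.dualObj W X F) ϕ ν)
        -- the randomness of the algorithm
        (Ω : Type*) (mΩ : MeasurableSpace Ω) (P : MeasureTheory.Measure Ω)
        (_ : MeasureTheory.IsProbabilityMeasure P) (ℱ : MeasureTheory.Filtration ℕ mΩ)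
        (Mb : ℕ → ℕ) (j : ℕ → Fin m → Ω → ℕ) (b : ℕ → Ω → Fin m)
        (ξ : (k : ℕ) → Ω → Fin (Mb k) → Ξ)
        (_ : ASBCDS.IsSampling P ℱ ν τ Mb j b ξ)
        -- the learning rate
        (γ : ℝ) (_ : 0 < γ)
        (_ : 3 * L * γ + 12 * L * γ * (((τ : ℝ) ^ 2 + τ) / m + 2 * τ) ^ 2 ≤ 1)
        (_ : c ≤ 3 * L * γ + 12 * L * γ * (((τ : ℝ) ^ 2 + τ) / m + 2 * τ) ^ 2)
        -- initial point, accuracy and number of iterations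
        (η₀ : ASBCDS.Vec m n) (ε : ℝ) (_ : 0 < ε) (K : ℕ)
        (_ : C * (m * τ * Real.sqrt L / Real.sqrt ε * ‖η₀ - ηs‖) ≤ K)
        -- the iterates
        (eta om : ℕ → Ω → ASBCDS.Vec m n)
        (_ : ∀ k s, eta k s = ASBCDS.etaSeq γ η₀ (fun i p => j i p s) (fun i => b i s)
          (fun i => ASBCDS.batchGradient ϕ (ξ i s)) k)
        (_ : ∀ k s, om k s = ASBCDS.omegaSeq γ η₀ (fun i p => j i p s) (fun i => b i s)
          (fun i => ASBCDS.batchGradient ϕ (ξ i s)) k)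
        -- the variance of the stochastic gradients that are used
        (_ : ∀ k ≤ K, ∫⁻ s, ‖gradient (ASBCDS.dualObj W X F) (om k s) -
            ASBCDS.batchGradient ϕ (ξ k s) (om k s)‖ₑ ^ 2 ∂P ≤
          ENNReal.ofReal (m * L * ASBCDS.theta m (k + 1) * ε / 8))
        -- the primal output
        (xK : Ω → ASBCDS.Vec m n)
        (_ : ∀ s, xK s = ASBCDS.primalOf X F (ASBCDS.sqrtOp W (eta (K + 1) s))),
        (MeasureTheory.Integrable (fun s => ‖xK s - xs‖ ^ 2) P ∧
          ∫ s, ‖xK s - xs‖ ^ 2 ∂P ≤ 2 * (ε / μ)) ∧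
        (MeasureTheory.Integrable (fun s => ‖ASBCDS.sqrtOp W (xK s)‖ ^ 2) P ∧
          ∫ s, ‖ASBCDS.sqrtOp W (xK s)‖ ^ 2 ∂P ≤ 2 * (ASBCDS.lambdaMax W * ε / μ)) := by
  have hsc : (0 : ℝ) < Real.sqrt c := Real.sqrt_pos.2 hc
  refine ⟨40 / Real.sqrt c, by positivity, ?_⟩
  intro m n τ hτ hm W hW X F μ hμ hF hmax xs ηs hxs hηs L hL Ξ _ ν _ ϕ ho Ω mΩ P _ ℱ Mb j b ξ h γ hγ
    hrate hrate' η₀ ε hε K hK eta om heta hom hvar xK hxK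
  -- The lower rate bound with `c > 0` excludes the degenerate case `L = 0`.
  have hL0 : 0 < L := by
    have h1 : 0 < L * (γ * (3 + 12 * (((τ : ℝ) ^ 2 + τ) / m + 2 * τ) ^ 2)) := by linarith
    exact pos_of_mul_pos_left h1 (by positivity)
  have hW0 : 0 < ASBCDS.lambdaMax W := by
    rw [hL] at hL0
    exact (div_pos_iff_of_pos_right hμ).1 hL0
  have hS := ASBCDS.isSmoothConvex_dualObj hW hμ hF hmax hW0.le
  rw [← hL, ← funext fun η => (hS.hasGradientAt η).gradient] at hS
  have hr := h.isRun (hτ.trans hm) ho γ η₀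
  rw [← show eta = _ from funext fun k => funext fun s => heta k s,
    ← show om = _ from funext fun k => funext fun s => hom k s] at hr
  obtain ⟨hmem, hle⟩ := hr.integral_sub_le hτ hm h ho (fun k s => by rw [hom]) hγ hL0 hS hηs hc hε
    hrate hrate' hK (fun k hk => by simpa only [← hom] using hvar k hk)
  have hint := ASBCDS.integrable_sub_minimum hS (hS.gradient_eq_zero hL0 hηs) hηs hmem
  have hgap : ∀ s, ‖xK s - xs‖ ^ 2 ≤ 2 / μ *
      (ASBCDS.dualObj W X F (eta (K + 1) s) - ASBCDS.dualObj W X F ηs) := by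
    intro s
    have h1 := ASBCDS.norm_primalOf_sub_sq_le hW hμ hF hmax hW0 hxs hηs (eta (K + 1) s)
    rw [← hxK] at h1
    rw [div_mul_eq_mul_div, le_div_iff₀ hμ]
    linarith
  have hxm : AEStronglyMeasurable xK P := by
    rw [show xK = _ from funext hxK]
    exact (ASBCDS.continuous_primalOf hμ hF hmax).comp_aestronglyMeasurable hmem.1
  have hx2 : MemLp (fun s => xK s - xs) 2 P :=
    ASBCDS.memLp_two_of_norm_sq_le (hxm.sub aestronglyMeasurable_const) (hint.const_mul _) hgap
  have hxi := ASBCDS.integrable_norm_sq hx2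
  have hxle : ∫ s, ‖xK s - xs‖ ^ 2 ∂P ≤ 2 * (ε / μ) := by
    refine (integral_mono hxi (hint.const_mul _) hgap).trans ?_
    rw [integral_const_mul]
    exact (mul_le_mul_of_nonneg_left hle (by positivity)).trans_eq (by ring)
  -- Since `√W xs = 0`, the consensus error equals `√W (xK - xs)`.
  have hA : ∀ s, ‖ASBCDS.sqrtOp W (xK s)‖ ^ 2 ≤ ASBCDS.lambdaMax W * ‖xK s - xs‖ ^ 2 := by
    intro s
    have h1 := ASBCDS.norm_sqrtOp_sq_le hW (xK s - xs)
    rwa [map_sub, hxs.1.2, sub_zero] at h1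
  have hAi := ASBCDS.integrable_norm_sq (ASBCDS.memLp_two_of_norm_sq_le
    ((ASBCDS.sqrtOp W).continuous.comp_aestronglyMeasurable hxm) (hxi.const_mul _) hA)
  refine ⟨⟨hxi, hxle⟩, hAi, (integral_mono hAi (hxi.const_mul _) hA).trans ?_⟩
  rw [integral_const_mul]
  exact (mul_le_mul_of_nonneg_left hxle hW0.le).trans_eq (by ring)
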